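/- Throughout, $\log$ is the logarithm to base $2$ and $[n]=\{1,\dots,n\}$. **The model.** A $\mathsf{4ANC}$ protocol $P$ for a function $f:\mathcal X\times\mathcal Y\to\mathcal Z$ involves Alice (who holds $x\in\mathcal X$), Bob (who holds $y\in\mathcal Y$), and two provers, Merlin and Megan, who know $x$ and $y$. An infinite string $r$ of independent fair public random bits is visible to all four. Merlin sends a message $m_{\rm mer}$ (a bit string) to Bob only; then Megan, who sees $m_{\rm mer}$, sends a message $m_{\rm meg}$ (a bit string) to Bob only; then Alice and Bob run a classical two-party public-coin protocol; finally Bob either rejects, or proceeds and outputs a value in $\mathcal Z$. The protocol specifies one message $M_{\rm mer}(x,y,r)$ that Merlin is supposed to send and, for every message $m_{\rm mer}$, at most one message $M_{\rm meg}(x,y,m_{\rm mer},r)$ that Megan is supposed to send; $M_{\rm meg}(x,y,M_{\rm mer}(x,y,r),r)$ is always defined. $P$ is *valid* if for all $x,y,m_{\rm mer},m_{\rm meg}$, with probability $1$ over $r$, Bob proceeds if and only if $m_{\rm meg}=M_{\rm meg}(x,y,m_{\rm mer},r)$. For a distribution $\mu$ on $\mathcal X\times\mathcal Y$, $P$ *$\delta$-solves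 $f$ under $\mu$ with communication cost $(c_A,c_B,c_M)$* if $P$ is valid and, with probability at least $\delta$ over $(x,y)\sim\mu$ and $r$, in the execution in which both provers send the messages they are supposed to send, Alice sends at most $c_A$ bits, Bob sends at most $c_B$ bits, Merlin sends at most $c_M$ bits, and Bob outputs $f(x,y)$ (Megan's message is not charged). Let $\mathrm{Suc}^{\mu}_f(c_A,c_B,c_M)$ be the supremum of all $\delta$ for which some $\mathsf{4ANC}$ protocol $\delta$-solves $f$ under $\mu$ with communication cost $(c_A,c_B,c_M)$. **The game.** In $G_{\mathsf{2D\text{-}ORC}}(k,q,n)$, Alice holds a $k$-tuple $x=((x_1,w_1),\dots,(x_k,w_k))$ of weighted points, $x_j\in[n]^2$, $w_j\in[n]$; Bob holds a $q$-tuple $y=(y_1,\dots,y_q)$ of points of $[n]^2$; the input distribution $\mu$ is uniform over all such pairs $(x,y)$; and the value to be computed is the $q$-tuple whose $i$-th coordinate is $\sum_{j:\,x_j\le y_i}w_j$, where $\le$ is the componentwise order. **Lemma ("direct product" for $\mathsf{2D\text{-}ORC}$ in the $\mathsf{4ANC}$ model).** Let $k=k(n)$ and $q=q(n)$ be natural numbers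 such that $\sqrt n\le k\le n$ for all sufficiently large $n$ and $k/q\sim\log^{1000}n$ (that is, $k/q=(1+o(1))(\log n)^{1000}$ as $n\to\infty$). Then for all sufficiently large $n$, $$\mathrm{Suc}^{\mu}_{G_{\mathsf{2D\text{-}ORC}}(k,q,n)}\bigl(0.5\sqrt{kq},\;0.005\,q\log n,\;0.0005\,q\log n\bigr)\;\le\;2^{-0.2\,q\log\log n}.$$ -/

import Mathlib

open MeasureTheory ProbabilityTheory Filter Asymptotics
open scoped ENNReal

noncomputable section

namespace FourANC

/-- Infinite public random strings. -/
abbrev Coins : Type := ℕ → Bool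

/-- Finite bit strings: the messages of the provers and the transcripts. -/
abbrev Bits : Type := List Bool

/-- The law of the public random string: independent fair bits. -/
def coinMeasure : Measure Coins :=
  Measure.infinitePi fun _ : ℕ => (PMF.uniformOfFintype Bool).toMeasure

/-- A quantity is determined measurably by the random string. -/
def CoinMeasurable {α : Type} (g : Coins → α) : Prop :=
  ∀ a : α, MeasurableSet {r | g r = a}

/-- What the protocol prescribes after a given partial transcript. -/
inductive Turn : Type
  | alice
  | bob
  | halt
  deriving DecidableEq

/-- The partial transcript after `i` steps, when `turn` decides who sends the next bit and
`a`, `b` give the bits sent by Alice and Bob as functions of the partial transcript. -/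
def history (turn : Bits → Turn) (a b : Bits → Bool) : ℕ → Bits
  | 0 => []
  | i + 1 =>
    match turn (history turn a b i) with
    | Turn.alice => history turn a b i ++ [a (history turn a b i)]
    | Turn.bob => history turn a b i ++ [b (history turn a b i)]
    | Turn.halt => history turn a b i

/-- A classical two-party communication protocol with public coins, presented bit by bit.
The next speaker is determined by the public string and the previous transcript; the bit sent
depends on the speaker's own input, the public string and the previous transcript. -/
structure PublicCoinProtocol (X Y : Type) where
  turn : Coins → Bits → Turn
  alice : X → Coins → Bits → Bool
  bob : Y → Coins → Bits → Bool
  turn_measurable : ∀ t, CoinMeasurable fun r => turn r t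
  alice_measurable : ∀ x t, CoinMeasurable fun r => alice x r t
  bob_measurable : ∀ y t, CoinMeasurable fun r => bob y r t
  halts : ∀ x y r, ∃ i, turn r (history (turn r) (alice x r) (bob y r) i) = Turn.halt

namespace PublicCoinProtocol

variable {X Y : Type}

/-- The complete transcript on inputs `x`, `y` and public string `r`. -/
def transcript (C : PublicCoinProtocol X Y) (x : X) (y : Y) (r : Coins) : Bits :=
  history (C.turn r) (C.alice x r) (C.bob y r) (Nat.find (C.halts x y r))

/-- The number of bits of the transcript `t` that were sent by the player `s`. -/
def bitsSent (C : PublicCoinProtocol X Y) (s : Turn) (r : Coins) (t : Bits) : ℕ :=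
  ((Finset.range t.length).filter fun i => C.turn r (t.take i) = s).card

end PublicCoinProtocol

/-- A protocol in the four-party nondeterministic model: Merlin and then Megan send a message to
Bob, then Alice and Bob communicate, and Bob rejects or outputs a value. Alice sees only her own
input, the public string and the conversation; Bob's view contains in addition both advice
messages. `merlin x y r` is the message Merlin is supposed to send, and `megan x y m r` is the
unique message Megan is supposed to send when Merlin has sent `m` (`none` if it is undefined). -/
structure Protocol (X Y Z : Type) where
  merlin : X → Y → Coins → Bits
  megan : X → Y → Bits → Coins → Option Bits
  megan_defined : ∀ x y r, (megan x y (merlin x y r) r).isSome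
  conv : PublicCoinProtocol X (Y × Bits × Bits)
  proceed : Y × Bits × Bits → Coins → Bits → Bool
  output : Y × Bits × Bits → Coins → Bits → Z
  merlin_measurable : ∀ x y, CoinMeasurable (merlin x y)
  megan_measurable : ∀ x y m, CoinMeasurable (megan x y m)
  proceed_measurable : ∀ v t, CoinMeasurable fun r => proceed v r t
  output_measurable : ∀ v t, CoinMeasurable fun r => output v r t

namespace Protocol

variable {X Y Z : Type}

/-- Bob proceeds in the execution in which Merlin sends `m` and Megan sends `g`. -/
def Proceeds (P : Protocol X Y Z) (x : X) (y : Y) (r : Coins) (m g : Bits) : Prop :=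
  P.proceed (y, m, g) r (P.conv.transcript x (y, m, g) r) = true

/-- Perfect verification of Megan: whatever Merlin and Megan send, with probability 1 Bob proceeds
if and only if Megan's message is the one she is supposed to send. -/
def Valid (P : Protocol X Y Z) : Prop :=
  ∀ (x : X) (y : Y) (m g : Bits),
    ∀ᵐ r ∂coinMeasure, P.Proceeds x y r m g ↔ P.megan x y m r = some g

/-- Megan's message in the honest execution. -/
def honestMegan (P : Protocol X Y Z) (x : X) (y : Y) (r : Coins) : Bits :=
  (P.megan x y (P.merlin x y r) r).get (P.megan_defined x y r)

/-- What Bob sees before the conversation starts, in the honest execution. -/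
def honestView (P : Protocol X Y Z) (x : X) (y : Y) (r : Coins) : Y × Bits × Bits :=
  (y, P.merlin x y r, P.honestMegan x y r)

/-- The conversation between Alice and Bob in the honest execution. -/
def honestTranscript (P : Protocol X Y Z) (x : X) (y : Y) (r : Coins) : Bits :=
  P.conv.transcript x (P.honestView x y r) r

/-- In the honest execution, Alice, Bob and Merlin send at most `cA`, `cB`, `cM` bits and Bob
proceeds and outputs `f x y`. -/
def Succeeds (P : Protocol X Y Z) (f : X → Y → Z) (cA cB cM : ℝ)
    (x : X) (y : Y) (r : Coins) : Prop :=
  (P.conv.bitsSent Turn.alice r (P.honestTranscript x y r) : ℝ) ≤ cA ∧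
  (P.conv.bitsSent Turn.bob r (P.honestTranscript x y r) : ℝ) ≤ cB ∧
  ((P.merlin x y r).length : ℝ) ≤ cM ∧
  P.Proceeds x y r (P.merlin x y r) (P.honestMegan x y r) ∧
  P.output (P.honestView x y r) r (P.honestTranscript x y r) = f x y

/-- `P` `δ`-solves `f` under the input distribution `μ` with communication cost `(cA, cB, cM)`. -/
def Solves [MeasurableSpace X] [MeasurableSpace Y] (P : Protocol X Y Z) (f : X → Y → Z)
    (μ : Measure (X × Y)) (cA cB cM : ℝ) (δ : ℝ≥0∞) : Prop :=
  P.Valid ∧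
    δ ≤ (μ.prod coinMeasure) {p : (X × Y) × Coins | P.Succeeds f cA cB cM p.1.1 p.1.2 p.2}

end Protocol

/-- The largest success probability of a four-party protocol for `f` under `μ` with communication
cost `(cA, cB, cM)` for Alice, Bob and Merlin. -/
def suc {X Y Z : Type} [MeasurableSpace X] [MeasurableSpace Y] (f : X → Y → Z)
    (μ : Measure (X × Y)) (cA cB cM : ℝ) : ℝ≥0∞ :=
  sSup {δ : ℝ≥0∞ | ∃ P : Protocol X Y Z, P.Solves f μ cA cB cM δ}

end FourANC

namespace ORC

/-- The grid `[n] × [n]`, with the componentwise order. -/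
abbrev Point (n : ℕ) : Type := Fin n × Fin n

/-- `k`-tuples of weighted points; the element `w` of `Fin n` stands for the weight `w + 1`, so that
weights range over `{1, …, n}`. -/
abbrev AliceInput (k n : ℕ) : Type := Fin k → Point n × Fin n

/-- `q`-tuples of query points. -/
abbrev BobInput (q n : ℕ) : Type := Fin q → Point n

/-- The `i`-th coordinate is the total weight of the points dominated by the `i`-th query. -/
def count2D (k q n : ℕ) (x : AliceInput k n) (y : BobInput q n) : Fin q → ℕ :=
  fun i => ∑ j ∈ Finset.univ.filter (fun j => (x j).1 ≤ y i), (((x j).2 : ℕ) + 1)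

/-- The uniform distribution on pairs of inputs. -/
def inputMeasure (k q n : ℕ) : Measure (AliceInput k n × BobInput q n) :=
  (uniformOn Set.univ).prod (uniformOn Set.univ)

end ORC

end

/-! Fix a public string for which the validity condition holds; validity makes Megan harmless. For a
Merlin message `m` and a transcript `τ`, the inputs of Alice compatible with `τ` form a set `S`, and
for `x ∈ S` the only message with which Bob follows `τ` and proceeds is the prescribed one. So Bob's
output is a function `G` of his input alone, and `Protocol.card_succeeds_le` reduces the lemma to a
statement without communication: for every `S` and `G`, the pairs of `S × Bᶜ` (with `B` a small set
of bad `y`) on which `G` is right number at most `β |S| |Y| + γ |X| |Y|`. Here `β` has to beat the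
bits of Bob and Merlin, and `γ` those of Alice too.

This is proved by taking many copies (`card_related_le`). If few `x` agree with `G` on all of `y₁,
…, y_m` for most `m`-tuples of good inputs, then the `m`-th moment of the number of `y` answered
correctly is small, and the power mean inequality gives the bound on every `S` of density above `γ`.
With `l = ⌊log n⌋`, take `m = 20 l^500` and `e = q l^500`, which is at least Alice's budget.

Why joint answers are unlikely (`card_answers_le`): suppose that the `m q` queries occupy many cells
of a grid whose cells each expect many points of Alice. Restricted to one parity class of cells, the
queries give a triangular system in the weights of points lying diagonally below them, so each such
point costs a factor `n`.

Why many cells are occupied on some scale (`card_spread_clumped_le`): a grid of scale `s` has coarse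
cells of area about `n² / q`, each split into `D` children by one base-`D` digit of the second
coordinate. If in each `y_j` at least half of the queries lie in cells with at most `l` queries of
`y_j`, then the tuple places at most `m l`, far fewer than `D`, of these queries in a coarse cell,
and they rarely collide in the children. With the first coordinates fixed, the digits of different
scales are independent, so failure on all scales has the product probability.

The bad `y` are those crowded on some scale. Their density is about `l^(-q/2)` up to factors
`2^O(q)` (`card_not_scattered_le`), and this governs the final bound `2^(-0.2 q log log n)`. -/

namespace FourANC

/-! ### Measurability of the events determined by the public string. -/

section Measurability

theorem CoinMeasurable.preimage {α : Type} [Countable α] {g : Coins → α} (hg : CoinMeasurable g)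
    (p : α → Prop) : MeasurableSet {r | p (g r)} := by
  have : {r | p (g r)} = ⋃ a ∈ {a | p a}, {r | g r = a} := by
    ext r; simp
  rw [this]
  exact MeasurableSet.biUnion (Set.to_countable _) fun a _ => hg a

/-- Composition of countably many measurable families. -/
theorem CoinMeasurable.bind {α β : Type} [Countable α] {g : Coins → α} {F : α → Coins → β}
    (hg : CoinMeasurable g) (hF : ∀ a, CoinMeasurable (F a)) :
    CoinMeasurable fun r => F (g r) r := by
  intro b
  have : {r | F (g r) r = b} = ⋃ a, {r | g r = a} ∩ {r | F a r = b} := by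
    ext r; simp
  rw [this]
  exact MeasurableSet.iUnion fun a => (hg a).inter (hF a b)

theorem CoinMeasurable.const {α : Type} (a : α) : CoinMeasurable fun _ => a := by
  intro b
  by_cases h : a = b <;> simp [h]

theorem CoinMeasurable.map {α β : Type} [Countable α] {g : Coins → α} (hg : CoinMeasurable g)
    (φ : α → β) : CoinMeasurable fun r => φ (g r) :=
  hg.bind (F := fun a _ => φ a) fun a => CoinMeasurable.const (φ a)

theorem CoinMeasurable.pair {α β : Type} [Countable α] [Countable β] {g : Coins → α}
    {h : Coins → β} (hg : CoinMeasurable g) (hh : CoinMeasurable h) :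
    CoinMeasurable fun r => (g r, h r) :=
  hg.bind (F := fun a r => (a, h r)) fun a => hh.map (Prod.mk a)

instance : Countable Turn :=
  Function.Injective.countable (f := fun t : Turn => (match t with
    | Turn.alice => 0 | Turn.bob => 1 | Turn.halt => 2 : ℕ)) (by
    intro a b; cases a <;> cases b <;> simp)

variable {X Y Z : Type}

theorem PublicCoinProtocol.history_measurable (C : PublicCoinProtocol X Y) (x : X) (y : Y)
    (i : ℕ) : CoinMeasurable fun r => history (C.turn r) (C.alice x r) (C.bob y r) i := by
  induction i with
  | zero => exact CoinMeasurable.const []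
  | succ i ih =>
    have h := ih.bind (F := fun t r => (t, C.turn r t, C.alice x r t, C.bob y r t)) fun t =>
      (CoinMeasurable.const t).pair
        ((C.turn_measurable t).pair ((C.alice_measurable x t).pair (C.bob_measurable y t)))
    exact h.map fun p : Bits × Turn × Bool × Bool => match p.2.1 with
      | Turn.alice => p.1 ++ [p.2.2.1]
      | Turn.bob => p.1 ++ [p.2.2.2]
      | Turn.halt => p.1

theorem PublicCoinProtocol.transcript_measurable (C : PublicCoinProtocol X Y) (x : X) (y : Y) :
    CoinMeasurable (C.transcript x y) := by
  have hh : ∀ i, MeasurableSet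
      {r | C.turn r (history (C.turn r) (C.alice x r) (C.bob y r) i) = Turn.halt} := fun i =>
    (C.history_measurable x y i).bind (F := fun t r => C.turn r t) C.turn_measurable Turn.halt
  have hfind : CoinMeasurable fun r => Nat.find (C.halts x y r) := by
    intro i
    simp only [Nat.find_eq_iff]
    simp only [Set.ofPred_and, Set.ofPred_forall]
    exact (hh i).inter (MeasurableSet.iInter fun j => MeasurableSet.iInter fun _ => (hh j).compl)
  exact hfind.bind (F := fun i r => history (C.turn r) (C.alice x r) (C.bob y r) i)
    (C.history_measurable x y)

theorem PublicCoinProtocol.bitsSent_measurable (C : PublicCoinProtocol X Y) (s : Turn) (t : Bits) :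
    CoinMeasurable fun r => C.bitsSent s r t := by
  have h : ∀ n : ℕ, CoinMeasurable fun r =>
      ((Finset.range n).filter fun i => C.turn r (t.take i) = s).card := by
    intro n
    induction n with
    | zero => exact CoinMeasurable.const 0
    | succ n ih =>
      have := (ih.pair (C.turn_measurable (t.take n))).map
        fun p : ℕ × Turn => if p.2 = s then p.1 + 1 else p.1
      convert this using 2 with r
      rw [Finset.range_add_one, Finset.filter_insert]
      split_ifs with h
      · rw [Finset.card_insert_of_notMem (by simp)]
      · rfl
  exact h _

theorem Protocol.honestMegan_measurable (P : Protocol X Y Z) (x : X) (y : Y) :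
    CoinMeasurable (P.honestMegan x y) := by
  have h := (P.merlin_measurable x y).bind (F := fun m r => P.megan x y m r)
    (P.megan_measurable x y)
  intro g
  convert h (some g) using 2
  ext r
  simp only [Protocol.honestMegan]
  exact (Option.eq_some_iff_get_eq.trans ⟨fun ⟨_, h⟩ => h, fun h => ⟨P.megan_defined x y r, h⟩⟩).symm

theorem Protocol.succeeds_measurable [Countable Y] [Countable Z] (P : Protocol X Y Z)
    (f : X → Y → Z) (cA cB cM : ℝ) (x : X) (y : Y) :
    MeasurableSet {r | P.Succeeds f cA cB cM x y r} := by
  have hv : CoinMeasurable (P.honestView x y) :=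
    (CoinMeasurable.const y).pair ((P.merlin_measurable x y).pair (P.honestMegan_measurable x y))
  have ht : CoinMeasurable (P.honestTranscript x y) :=
    hv.bind (F := fun v r => P.conv.transcript x v r) fun v => P.conv.transcript_measurable x v
  have hA := ht.bind (F := fun t r => P.conv.bitsSent Turn.alice r t)
    (P.conv.bitsSent_measurable Turn.alice)
  have hB := ht.bind (F := fun t r => P.conv.bitsSent Turn.bob r t)
    (P.conv.bitsSent_measurable Turn.bob)
  have hp := (hv.pair ht).bind (F := fun p r => P.proceed p.1 r p.2)
    fun p => P.proceed_measurable p.1 p.2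
  have ho := (hv.pair ht).bind (F := fun p r => P.output p.1 r p.2)
    fun p => P.output_measurable p.1 p.2
  refine ((hA.preimage fun c => (c : ℝ) ≤ cA).inter ((hB.preimage fun c => (c : ℝ) ≤ cB).inter
    (((P.merlin_measurable x y).preimage fun m => (m.length : ℝ) ≤ cM).inter
      ((hp true).inter (ho (f x y))))))

end Measurability

/-! ### Reduction to a fixed public string. -/

instance : IsProbabilityMeasure coinMeasure := by
  unfold coinMeasure; infer_instance

/-- A bound for the number of inputs on which a valid protocol succeeds, for almost every public
string, bounds the largest success probability under the uniform distribution. -/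
theorem suc_uniform_le {X Y Z : Type} [Fintype X] [Fintype Y] [Nonempty X] [Nonempty Y]
    [Countable Z] [MeasurableSpace X] [MeasurableSpace Y] [MeasurableSingletonClass X]
    [MeasurableSingletonClass Y] (f : X → Y → Z) (cA cB cM : ℝ) (ε : ℝ≥0∞)
    (h : ∀ (P : Protocol X Y Z) (r : Coins),
      (∀ x y m g, P.Proceeds x y r m g ↔ P.megan x y m r = some g) →
      (Nat.card {p : X × Y // P.Succeeds f cA cB cM p.1 p.2 r} : ℝ≥0∞) ≤
        ε * (Fintype.card X * Fintype.card Y : ℕ)) :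
    suc f ((uniformOn Set.univ).prod (uniformOn Set.univ)) cA cB cM ≤ ε := by
  classical
  refine sSup_le ?_
  rintro δ ⟨P, hval, hδ⟩
  refine hδ.trans ?_
  set μ : Measure (X × Y) := (uniformOn Set.univ).prod (uniformOn Set.univ)
  set A : X × Y → Set Coins := fun p => {r | P.Succeeds f cA cB cM p.1 p.2 r}
  have hA : ∀ p, MeasurableSet (A p) := fun p => P.succeeds_measurable f cA cB cM p.1 p.2
  have hsub : {p : (X × Y) × Coins | P.Succeeds f cA cB cM p.1.1 p.1.2 p.2} ⊆
      ⋃ p : X × Y, ({p} : Set (X × Y)) ×ˢ A p := by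
    intro p hp
    simp only [Set.mem_iUnion]
    exact ⟨p.1, rfl, hp⟩
  have hμ : ∀ p : X × Y, μ {p} = ((Fintype.card X * Fintype.card Y : ℕ) : ℝ≥0∞)⁻¹ := by
    rintro ⟨x, y⟩
    have : ({(x, y)} : Set (X × Y)) = {x} ×ˢ {y} := by simp
    rw [this, Measure.prod_prod, uniformOn_univ, uniformOn_univ]
    simp only [Measure.count_singleton, Nat.cast_mul, one_div]
    rw [ENNReal.mul_inv] <;> simp
  calc (μ.prod coinMeasure) {p : (X × Y) × Coins | P.Succeeds f cA cB cM p.1.1 p.1.2 p.2}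
      ≤ ∑ p : X × Y, (μ.prod coinMeasure) (({p} : Set (X × Y)) ×ˢ A p) :=
        (measure_mono hsub).trans (measure_iUnion_fintype_le _ _)
    _ = ((Fintype.card X * Fintype.card Y : ℕ) : ℝ≥0∞)⁻¹ * ∑ p : X × Y, coinMeasure (A p) := by
        rw [Finset.mul_sum]
        exact Finset.sum_congr rfl fun p _ => by rw [Measure.prod_prod, hμ]
    _ = ((Fintype.card X * Fintype.card Y : ℕ) : ℝ≥0∞)⁻¹ *
          ∫⁻ r, ∑ p : X × Y, (A p).indicator 1 r ∂coinMeasure := by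
        rw [lintegral_finsetSum]
        · simp [lintegral_indicator_one (hA _)]
        · exact fun p _ => measurable_one.indicator (hA p)
    _ ≤ ((Fintype.card X * Fintype.card Y : ℕ) : ℝ≥0∞)⁻¹ *
          ∫⁻ r, ε * (Fintype.card X * Fintype.card Y : ℕ) ∂coinMeasure := by
        refine mul_le_mul_right (lintegral_mono_ae ?_) _
        -- Inputs and messages are countable, so one null set serves for all of them.
        have hae : ∀ᵐ r ∂coinMeasure, ∀ x y m g,
            P.Proceeds x y r m g ↔ P.megan x y m r = some g := by
          rw [ae_all_iff]; intro x
          rw [ae_all_iff]; intro y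
          rw [ae_all_iff]; intro m
          rw [ae_all_iff]; intro g
          exact hval x y m g
        filter_upwards [hae] with r hr
        refine le_trans (le_of_eq ?_) (h P r hr)
        rw [Nat.card_eq_fintype_card, Fintype.card_subtype, Finset.card_filter]
        push_cast
        refine Finset.sum_congr rfl fun p _ => ?_
        simp [A, Set.indicator_apply]
    _ = ε := by
        rw [lintegral_const, measure_univ, mul_one, mul_comm ε, ← mul_assoc,
          ENNReal.inv_mul_cancel, one_mul]
        · exact_mod_cast (Nat.mul_pos Fintype.card_pos Fintype.card_pos).ne'
        · exact ENNReal.natCast_ne_top _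

end FourANC

namespace FourANC

/-! ### Counting transcripts and messages. -/

section Transcripts

/-- The number of bits of `t` sent by `s`. -/
def turnCount (turn : Bits → Turn) (s : Turn) (t : Bits) : ℕ :=
  ((Finset.range t.length).filter fun i => turn (t.take i) = s).card

/-- `t` is a complete transcript of some execution of the protocol tree `turn`. -/
def IsLeaf (turn : Bits → Turn) (t : Bits) : Prop :=
  turn t = Turn.halt ∧ ∀ i < t.length, turn (t.take i) ≠ Turn.halt

/-- The bits of `t` sent by `s` agree with the strategy `a`. -/
def Follows (turn : Bits → Turn) (s : Turn) (a : Bits → Bool) (t : Bits) : Prop :=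
  ∀ i, (h : i < t.length) → turn (t.take i) = s → t[i] = a (t.take i)

variable {turn : Bits → Turn} {a b : Bits → Bool} {t : Bits}

theorem history_eq_take (ht : IsLeaf turn t) (ha : Follows turn Turn.alice a t)
    (hb : Follows turn Turn.bob b t) {i : ℕ} (hi : i ≤ t.length) :
    history turn a b i = t.take i := by
  induction i with
  | zero => simp [history]
  | succ i ih =>
    have hi' : i < t.length := hi
    rw [history, ih hi'.le, List.take_add_one, List.getElem?_eq_getElem hi']
    have := ht.2 i hi'
    cases h : turn (t.take i) with
    | alice => simp [ha i hi' h]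
    | bob => simp [hb i hi' h]
    | halt => exact absurd h this

theorem history_of_leaf (ht : IsLeaf turn t) (ha : Follows turn Turn.alice a t)
    (hb : Follows turn Turn.bob b t) (hex : ∃ i, turn (history turn a b i) = Turn.halt) :
    history turn a b (Nat.find hex) = t := by
  have : Nat.find hex = t.length := by
    rw [Nat.find_eq_iff]
    constructor
    · rw [history_eq_take ht ha hb le_rfl, List.take_length]; exact ht.1
    · intro i hi
      rw [history_eq_take ht ha hb hi.le]
      exact ht.2 i hi
  rw [this, history_eq_take ht ha hb le_rfl, List.take_length]

/-- Both leaves are the transcript of the single execution with strategies `a` and `b`. Hence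
strategies can serve as codes for leaves. -/
theorem IsLeaf.eq_of_follows {t' : Bits} (ht : IsLeaf turn t) (ha : Follows turn Turn.alice a t)
    (hb : Follows turn Turn.bob b t) (ht' : IsLeaf turn t')
    (ha' : Follows turn Turn.alice a t') (hb' : Follows turn Turn.bob b t') : t = t' := by
  have hex : ∃ i, turn (history turn a b i) = Turn.halt :=
    ⟨t.length, by rw [history_eq_take ht ha hb le_rfl, List.take_length]; exact ht.1⟩
  rw [← history_of_leaf ht ha hb hex, history_of_leaf ht' ha' hb' hex]

theorem history_succ_of_not_halt {i : ℕ} (h : turn (history turn a b i) ≠ Turn.halt) :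
    history turn a b (i + 1) = history turn a b i ++
      [if turn (history turn a b i) = Turn.alice then a (history turn a b i)
        else b (history turn a b i)] := by
  rw [history]
  cases h' : turn (history turn a b i) with
  | alice => simp
  | bob => simp
  | halt => exact absurd h' h

theorem history_take {N : ℕ} (hN : ∀ i < N, turn (history turn a b i) ≠ Turn.halt) :
    (history turn a b N).length = N ∧
      ∀ i ≤ N, (history turn a b N).take i = history turn a b i := by
  induction N with
  | zero => simp [history]
  | succ N ih =>
    obtain ⟨h1, h2⟩ := ih fun i hi => hN i (by omega)
    have h3 := history_succ_of_not_halt (hN N (by omega))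
    have h4 : (history turn a b (N + 1)).length = N + 1 := by rw [h3]; simp [h1]
    refine ⟨h4, fun i hi => ?_⟩
    rcases Nat.lt_or_ge N i with h | h
    · have : i = N + 1 := by omega
      subst this
      rw [List.take_of_length_le h4.le]
    · rw [h3, List.take_append_of_le_length (by omega), h2 i h]

theorem transcript_follows (hex : ∃ i, turn (history turn a b i) = Turn.halt) :
    IsLeaf turn (history turn a b (Nat.find hex)) ∧
      Follows turn Turn.alice a (history turn a b (Nat.find hex)) ∧
      Follows turn Turn.bob b (history turn a b (Nat.find hex)) := by
  have hN : ∀ i < Nat.find hex, turn (history turn a b i) ≠ Turn.halt :=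
    fun i hi => Nat.find_min hex hi
  obtain ⟨hlen, htake⟩ := history_take hN
  have hget : ∀ i (h : i < (history turn a b (Nat.find hex)).length),
      (history turn a b (Nat.find hex))[i] =
        if turn (history turn a b i) = Turn.alice then a (history turn a b i)
          else b (history turn a b i) := by
    intro i h
    have hi : i < Nat.find hex := by omega
    have h1 := (history_take (N := i) fun j hj => hN j (by omega)).1
    have h2 := htake (i + 1) (by omega)
    rw [history_succ_of_not_halt (hN i hi)] at h2
    have h3 : ((history turn a b (Nat.find hex)).take (i + 1))[i]'(by simp; omega) =
      (history turn a b (Nat.find hex))[i] := by simp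
    rw [← h3]
    simp only [h2]
    simp [h1]
  refine ⟨⟨Nat.find_spec hex, fun i hi => ?_⟩, fun i hi h => ?_, fun i hi h => ?_⟩
  · rw [htake i (by omega)]
    exact hN i (by omega)
  · rw [htake i (by omega)] at h ⊢
    rw [hget i hi, if_pos h]
  · rw [htake i (by omega)] at h ⊢
    rw [hget i hi, if_neg (by simp [h])]

theorem turnCount_take (s : Turn) {i : ℕ} (hi : i ≤ t.length) :
    turnCount turn s (t.take i) = ((Finset.range i).filter fun j => turn (t.take j) = s).card := by
  unfold turnCount
  rw [List.length_take, min_eq_left hi]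
  congr 1
  refine Finset.filter_congr fun j hj => ?_
  rw [List.take_take, min_eq_left (Finset.mem_range.1 hj).le]

theorem turnCount_take_lt (s : Turn) {i j : ℕ} (hij : i < j) (hj : j ≤ t.length)
    (h : turn (t.take i) = s) : turnCount turn s (t.take i) < turnCount turn s (t.take j) := by
  rw [turnCount_take s (by omega), turnCount_take s hj]
  refine Finset.card_lt_card (Finset.ssubset_iff_of_subset ?_ |>.2 ⟨i, ?_, ?_⟩)
  · exact Finset.filter_subset_filter _ (Finset.range_subset_range.2 hij.le)
  · simp [hij, h]
  · simp

/-- The strategy that sends the bits of `β` one after the other. -/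
def scripted (turn : Bits → Turn) (s : Turn) {c : ℕ} (β : Fin c → Bool) (t : Bits) : Bool :=
  if h : turnCount turn s t < c then β ⟨turnCount turn s t, h⟩ else false

theorem exists_script (s : Turn) {c : ℕ} (hc : turnCount turn s t ≤ c) :
    ∃ β : Fin c → Bool, Follows turn s (scripted turn s β) t := by
  classical
  -- Bit `k` of the script is the bit sent after `k` earlier turns of `s`. The position is unique
  -- because `turnCount` grows strictly at each turn of `s`.
  refine ⟨fun k => decide (∃ i, ∃ h : i < t.length, turn (t.take i) = s ∧
    turnCount turn s (t.take i) = k ∧ t[i] = true), fun i hi h => ?_⟩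
  have hlt : turnCount turn s (t.take i) < c := by
    have := turnCount_take_lt s hi le_rfl h
    rw [List.take_length] at this
    omega
  rw [scripted, dif_pos hlt]
  cases hb : t[i] with
  | true => exact (decide_eq_true ⟨i, hi, h, rfl, hb⟩).symm
  | false =>
    symm
    rw [decide_eq_false_iff_not]
    rintro ⟨j, hj, hj', heq, hbj⟩
    have : i = j := by
      rcases lt_trichotomy i j with h1 | h1 | h1
      · exact absurd heq.symm (turnCount_take_lt s h1 hj.le h).ne
      · exact h1
      · exact absurd heq (turnCount_take_lt s h1 hi.le hj').ne
    subst this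
    simp_all

/-- Leaves with bounded communication. -/
def leaves (turn : Bits → Turn) (cA cB : ℕ) : Set Bits :=
  {t | IsLeaf turn t ∧ turnCount turn Turn.alice t ≤ cA ∧ turnCount turn Turn.bob t ≤ cB}

theorem exists_injOn_card_le {α β : Type} [Fintype β] {s : Set α} (φ : α → β)
    (h : Set.InjOn φ s) : s.Finite ∧ s.ncard ≤ Fintype.card β := by
  have hf : s.Finite := Set.Finite.of_injOn (Set.mapsTo_univ φ s) h Set.finite_univ
  refine ⟨hf, ?_⟩
  rw [← h.ncard_image, ← Nat.card_eq_fintype_card, ← Set.ncard_univ]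
  exact Set.ncard_le_ncard (Set.subset_univ _)

/-- The two scripts of sent bits determine the leaf. -/
theorem leaves_card (turn : Bits → Turn) (cA cB : ℕ) :
    (leaves turn cA cB).Finite ∧ (leaves turn cA cB).ncard ≤ 2 ^ cA * 2 ^ cB := by
  classical
  have h : ∀ t : Bits, ∃ p : (Fin cA → Bool) × (Fin cB → Bool), t ∈ leaves turn cA cB →
      Follows turn Turn.alice (scripted turn Turn.alice p.1) t ∧
      Follows turn Turn.bob (scripted turn Turn.bob p.2) t := by
    intro t
    by_cases ht : t ∈ leaves turn cA cB
    · obtain ⟨α, hα⟩ := exists_script Turn.alice ht.2.1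
      obtain ⟨β, hβ⟩ := exists_script Turn.bob ht.2.2
      exact ⟨(α, β), fun _ => ⟨hα, hβ⟩⟩
    · exact ⟨(fun _ => false, fun _ => false), fun h => absurd h ht⟩
  choose φ hφ using h
  have := exists_injOn_card_le (s := leaves turn cA cB) φ fun t ht t' ht' heq =>
    ht.1.eq_of_follows (hφ t ht).1 (hφ t ht).2 ht'.1 (heq ▸ (hφ t' ht').1)
      (heq ▸ (hφ t' ht').2)
  simpa using this

/-- With Alice's strategy fixed only Bob's script is free. This is why Alice's bits are not charged
against `β` in `Protocol.card_succeeds_le`. -/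
theorem leaves_follows_card (turn : Bits → Turn) (cA cB : ℕ) (a : Bits → Bool) :
    {t ∈ leaves turn cA cB | Follows turn Turn.alice a t}.ncard ≤ 2 ^ cB := by
  classical
  have h : ∀ t : Bits, ∃ p : Fin cB → Bool, t ∈ leaves turn cA cB →
      Follows turn Turn.bob (scripted turn Turn.bob p) t := by
    intro t
    by_cases ht : t ∈ leaves turn cA cB
    · obtain ⟨β, hβ⟩ := exists_script Turn.bob ht.2.2
      exact ⟨β, fun _ => hβ⟩
    · exact ⟨fun _ => false, fun h => absurd h ht⟩
  choose φ hφ using h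
  have := exists_injOn_card_le (s := {t ∈ leaves turn cA cB | Follows turn Turn.alice a t}) φ
    fun t ht t' ht' heq =>
      ht.1.1.eq_of_follows ht.2 (hφ t ht.1) ht'.1.1 ht'.2 (heq ▸ hφ t' ht'.1)
  simpa using this.2

/-- A message is coded by its length and its padding to `c` bits. -/
theorem messages_card (c : ℕ) :
    {m : Bits | m.length ≤ c}.Finite ∧ {m : Bits | m.length ≤ c}.ncard ≤ (c + 1) * 2 ^ c := by
  have := exists_injOn_card_le (s := {m : Bits | m.length ≤ c})
    (fun m => ((Fin.ofNat (c + 1) m.length, fun i : Fin c => m.getD i false) :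
      Fin (c + 1) × (Fin c → Bool))) (by
    intro m hm m' hm' h
    simp only [Set.mem_ofPred_eq] at hm hm'
    simp only [Prod.mk.injEq] at h
    have h1 : m.length = m'.length := by
      have := congrArg Fin.val h.1
      simpa [Nat.mod_eq_of_lt (Nat.lt_succ_of_le hm),
        Nat.mod_eq_of_lt (Nat.lt_succ_of_le hm')] using this
    refine List.ext_getElem h1 fun i hi hi' => ?_
    have := congrFun h.2 ⟨i, by omega⟩
    simpa [hi, hi'] using this)
  simpa using this

end Transcripts

/-! ### Removing the provers and the conversation. -/

/-- If, on every set `S` of inputs of Alice, every guess depending only on Bob's input is correct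
for few pairs outside the set `Bad`, then a valid protocol succeeds for few pairs. -/
theorem Protocol.card_succeeds_le {X Y Z : Type} [Fintype X] [Fintype Y] [DecidableEq Z]
    [DecidableEq Y] (P : Protocol X Y Z) (r : Coins)
    (hval : ∀ x y m g, P.Proceeds x y r m g ↔ P.megan x y m r = some g)
    (f : X → Y → Z) (cA cB cM : ℕ) (Bad : Finset Y) (β γ : ℝ) (hβ : 0 ≤ β)
    (hγ : 0 ≤ γ)
    (hcore : ∀ (S : Finset X) (G : Y → Z),
      (((S ×ˢ Badᶜ).filter fun p => f p.1 p.2 = G p.2).card : ℝ) ≤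
        β * S.card * Fintype.card Y + γ * Fintype.card X * Fintype.card Y) :
    (Nat.card {p : X × Y // P.Succeeds f cA cB cM p.1 p.2 r} : ℝ) ≤
      (Bad.card + (cM + 1) * 2 ^ cM * (2 ^ cB * β + 2 ^ cA * 2 ^ cB * γ) * Fintype.card Y) *
        Fintype.card X := by
  classical
  set turn := P.conv.turn r with hturn
  set S : Bits → Finset X := fun τ =>
    Finset.univ.filter fun x => Follows turn Turn.alice (P.conv.alice x r) τ with hS
  -- Megan's message is not guessed but reconstructed: any `g` with which Bob follows `τ` and
  -- proceeds will do, by `hmeg` below. The other branch is an arbitrary default.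
  set G : Bits → Bits → Y → Z := fun m τ y =>
    if h : ∃ g, Follows turn Turn.bob (P.conv.bob (y, m, g) r) τ ∧
      P.proceed (y, m, g) r τ = true then P.output (y, m, h.choose) r τ
    else P.output (y, m, []) r τ with hG
  obtain ⟨hMfin, hMcard⟩ := messages_card cM
  obtain ⟨hLfin, hLcard⟩ := leaves_card turn cA cB
  set M := hMfin.toFinset with hM
  set L := hLfin.toFinset with hL
  -- For every `x` compatible with `τ` the execution really produces `τ`, so validity identifies `g`
  -- with the prescribed message.
  have hmeg : ∀ x y m g τ, IsLeaf turn τ → Follows turn Turn.alice (P.conv.alice x r) τ →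
      Follows turn Turn.bob (P.conv.bob (y, m, g) r) τ → P.proceed (y, m, g) r τ = true →
      P.megan x y m r = some g := by
    intro x y m g τ h1 h2 h3 h4
    rw [← hval]
    have : P.conv.transcript x (y, m, g) r = τ :=
      history_of_leaf h1 h2 h3 (P.conv.halts x (y, m, g) r)
    rw [Protocol.Proceeds, this]
    exact h4
  set R : Bits → Bits → Finset (X × Y) := fun m τ =>
    (S τ ×ˢ Badᶜ).filter fun p => f p.1 p.2 = G m τ p.2
  have hsub : (Finset.univ.filter fun p : X × Y => P.Succeeds f cA cB cM p.1 p.2 r) ⊆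
      (Finset.univ ×ˢ Bad) ∪ M.biUnion fun m => L.biUnion fun τ => R m τ := by
    rintro ⟨x, y⟩ hp
    obtain ⟨hA, hB, hm, hpr, ho⟩ := (Finset.mem_filter.1 hp).2
    by_cases hy : y ∈ Bad
    · exact Finset.mem_union_left _ (by simp [hy])
    refine Finset.mem_union_right _ ?_
    obtain ⟨hleaf, hfa, hfb⟩ : IsLeaf turn (P.honestTranscript x y r) ∧
        Follows turn Turn.alice (P.conv.alice x r) (P.honestTranscript x y r) ∧
        Follows turn Turn.bob (P.conv.bob (P.honestView x y r) r) (P.honestTranscript x y r) :=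
      transcript_follows (P.conv.halts x (P.honestView x y r) r)
    refine Finset.mem_biUnion.2 ⟨P.merlin x y r, ?_, Finset.mem_biUnion.2
      ⟨P.honestTranscript x y r, ?_, ?_⟩⟩
    · simpa [hM] using hm
    · rw [hL, Set.Finite.mem_toFinset]
      exact ⟨hleaf, by exact_mod_cast hA, by exact_mod_cast hB⟩
    · refine Finset.mem_filter.2 ⟨by simp [hS, hy, hfa], ?_⟩
      have hex : ∃ g, Follows turn Turn.bob (P.conv.bob (y, P.merlin x y r, g) r)
          (P.honestTranscript x y r) ∧
          P.proceed (y, P.merlin x y r, g) r (P.honestTranscript x y r) = true :=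
        ⟨P.honestMegan x y r, hfb, hpr⟩
      have h1 := hmeg x y _ _ _ hleaf hfa hex.choose_spec.1 hex.choose_spec.2
      have h2 := (hval x y _ _).1 hpr
      have h3 : hex.choose = P.honestMegan x y r := Option.some.inj (h1.symm.trans h2)
      simp only [hG]
      rw [dif_pos hex, h3]
      exact ho.symm
  have hMr : (M.card : ℝ) ≤ (cM + 1) * 2 ^ cM := by
    rw [hM, ← Set.ncard_eq_toFinset_card _ hMfin]; exact_mod_cast hMcard
  have hLr : (L.card : ℝ) ≤ 2 ^ cA * 2 ^ cB := by
    rw [hL, ← Set.ncard_eq_toFinset_card _ hLfin]; exact_mod_cast hLcard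
  -- Double counting: each `x` is compatible with at most `2 ^ cB` leaves.
  have hSr : ∑ τ ∈ L, ((S τ).card : ℝ) ≤ 2 ^ cB * Fintype.card X := by
    have h1 : ∑ τ ∈ L, (S τ).card =
        ∑ x : X, (L.filter fun τ => Follows turn Turn.alice (P.conv.alice x r) τ).card :=
      Finset.sum_card_bipartiteAbove_eq_sum_card_bipartiteBelow _
    have h2 : ∀ x : X,
        (L.filter fun τ => Follows turn Turn.alice (P.conv.alice x r) τ).card ≤ 2 ^ cB := by
      intro x
      have h3 := leaves_follows_card turn cA cB (P.conv.alice x r)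
      rw [← Set.ncard_coe_finset]
      simpa [hL] using h3
    have h4 := Finset.sum_le_card_nsmul Finset.univ _ _ fun x _ => h2 x
    rw [← h1] at h4
    rw [mul_comm]
    simpa using (Nat.cast_le (α := ℝ)).2 h4
  rw [Nat.card_eq_fintype_card, Fintype.card_subtype]
  calc ((Finset.univ.filter fun p : X × Y => P.Succeeds f cA cB cM p.1 p.2 r).card : ℝ)
      ≤ ((Finset.univ ×ˢ Bad : Finset (X × Y)).card + ∑ m ∈ M, ∑ τ ∈ L, (R m τ).card : ℕ) := by
        refine Nat.cast_le.2 ((Finset.card_le_card hsub).trans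
          ((Finset.card_union_le _ _).trans ?_))
        refine Nat.add_le_add_left (Finset.card_biUnion_le.trans ?_) _
        exact Finset.sum_le_sum fun m _ => Finset.card_biUnion_le
    _ ≤ Fintype.card X * Bad.card + ∑ m ∈ M, ∑ τ ∈ L,
          (β * (S τ).card * Fintype.card Y + γ * Fintype.card X * Fintype.card Y) := by
        push_cast
        rw [Finset.card_product, Finset.card_univ]
        push_cast
        gcongr with m _ τ _
        exact hcore _ _
    _ = Fintype.card X * Bad.card + M.card * (β * Fintype.card Y * ∑ τ ∈ L, ((S τ).card : ℝ) +
          L.card * (γ * Fintype.card X * Fintype.card Y)) := by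
        rw [Finset.sum_const, nsmul_eq_mul, Finset.sum_add_distrib, Finset.sum_const,
          nsmul_eq_mul, Finset.mul_sum]
        congr 3
        exact Finset.sum_congr rfl fun τ _ => by ring
    _ ≤ Fintype.card X * Bad.card + (cM + 1) * 2 ^ cM *
          (β * Fintype.card Y * (2 ^ cB * Fintype.card X) +
          2 ^ cA * 2 ^ cB * (γ * Fintype.card X * Fintype.card Y)) := by
        have h1 : 0 ≤ β * Fintype.card Y := by positivity
        have h2 : 0 ≤ γ * Fintype.card X * Fintype.card Y := by positivity
        refine add_le_add le_rfl (mul_le_mul hMr ?_ ?_ (by positivity))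
        · exact add_le_add (mul_le_mul_of_nonneg_left hSr h1) (mul_le_mul_of_nonneg_right hLr h2)
        · exact add_nonneg (mul_nonneg h1 (Finset.sum_nonneg fun τ _ => Nat.cast_nonneg _))
            (mul_nonneg (Nat.cast_nonneg _) h2)
    _ = _ := by ring

end FourANC

namespace ORC

/-! ### Inputs of Bob concentrated on few cells. -/

section Crowding

variable {Ω P : Type} [Fintype Ω] [DecidableEq P]

/-- The number of indices whose point lies in the same cell as the point with index `i`. -/
def load {I : Type} [Fintype I] (p : I → P) (i : I) : ℕ :=
  (Finset.univ.filter fun j => p j = p i).card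

/-- At most half of the points lie in cells with more than `l` points. -/
def Scattered {I : Type} [Fintype I] (l : ℕ) (p : I → P) : Prop :=
  2 * (Finset.univ.filter fun i => l < load p i).card ≤ Fintype.card I

/-- Cells with more than `l` of the `q` points number at most `q / l`, so a list of that length,
with repetitions, names them all. -/
theorem exists_cover_of_not_scattered {q l : ℕ} (hl : 0 < l) (p : Fin q → P)
    (h : ¬ Scattered l p) (Q : Finset P) (hQ : ∀ i, p i ∈ Q) :
    ∃ ψ ∈ Fintype.piFinset fun _ : Fin (q / l) => Q,
      ∀ i ∈ Finset.univ.filter fun i => l < load p i, ∃ a, ψ a = p i := by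
  classical
  set F := Finset.univ.filter fun i => l < load p i with hF
  set O := F.image p with hO
  have hFne : F.Nonempty := by
    rw [Finset.nonempty_iff_ne_empty]
    intro h0
    apply h
    unfold Scattered
    rw [← hF, h0]; simp
  have hcard : O.card ≤ q / l := by
    rw [Nat.le_div_iff_mul_le hl]
    have h1 : ∀ c ∈ O, l ≤ (Finset.univ.filter fun j : Fin q => p j = c).card := by
      intro c hc
      obtain ⟨i, hi, rfl⟩ := Finset.mem_image.1 hc
      exact (Finset.mem_filter.1 hi).2.le
    have h2 := Finset.sum_le_sum h1
    rw [Finset.sum_const, smul_eq_mul] at h2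
    refine h2.trans ?_
    rw [← Finset.card_biUnion]
    · exact (Finset.card_le_univ _).trans (by simp)
    · intro c _ c' _ hcc
      rw [Function.onFun, Finset.disjoint_left]
      intro j hj hj'
      exact hcc ((Finset.mem_filter.1 hj).2.symm.trans (Finset.mem_filter.1 hj').2)
  obtain ⟨i0, hi0⟩ := hFne
  have hOne : Nonempty O := ⟨⟨p i0, Finset.mem_image_of_mem p hi0⟩⟩
  have hOne' : 0 < Fintype.card O := Fintype.card_pos
  obtain ⟨φ, hφ⟩ : ∃ φ : Fin (q / l) → O, Function.Surjective φ := by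
    have e := (Fintype.equivFin O).symm
    have hle : Fintype.card O ≤ q / l := by simpa using hcard
    refine ⟨fun a => if h : a.1 < Fintype.card O then e ⟨a, h⟩ else e ⟨0, hOne'⟩, fun c => ?_⟩
    refine ⟨⟨(e.symm c).1, (e.symm c).2.trans_le hle⟩, ?_⟩
    simp only [dif_pos (e.symm c).2, Fin.eta, Equiv.apply_symm_apply]
  refine ⟨fun a => (φ a).1, ?_, ?_⟩
  · rw [Fintype.mem_piFinset]
    intro a
    obtain ⟨i, _, hi⟩ := Finset.mem_image.1 (φ a).2
    rw [← hi]; exact hQ i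
  · intro i hi
    obtain ⟨a, ha⟩ := hφ ⟨p i, Finset.mem_image_of_mem p hi⟩
    exact ⟨a, congrArg Subtype.val ha⟩

/-- Union bound over the list of crowded cells and the set `F` of at least `q / 2` indices falling
into them. The listed cells cover at most `(q / l) (1 / q) ≤ 1 / l` of `Ω`, and each index of `F`
pays this factor. -/
theorem card_not_scattered_le [DecidableEq Ω] {q l : ℕ} (hl : 0 < l) (cell : Ω → P) (Q : Finset P)
    (hQ : ∀ z, cell z ∈ Q) (hcell : ∀ c, q * (Finset.univ.filter fun z => cell z = c).card ≤
      Fintype.card Ω) :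
    (Nat.card {y : Fin q → Ω // ¬ Scattered l fun i => cell (y i)} : ℝ) ≤
      (Q.card : ℝ) ^ (q / l) * 2 ^ q * ((1 / √l) ^ q * (Fintype.card Ω : ℝ) ^ q) := by
  classical
  set Ψ := Fintype.piFinset fun _ : Fin (q / l) => Q
  set 𝓕 := (Finset.univ : Finset (Finset (Fin q))).filter fun F => q ≤ 2 * F.card
  set W : (Fin (q / l) → P) → Finset (Fin q) → Finset (Fin q → Ω) := fun ψ F =>
    Fintype.piFinset fun i => if i ∈ F then Finset.univ.filter fun z => ∃ a, ψ a = cell z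
      else Finset.univ
  have hsub : (Finset.univ.filter fun y : Fin q → Ω => ¬ Scattered l fun i => cell (y i)) ⊆
      Ψ.biUnion fun ψ => 𝓕.biUnion fun F => W ψ F := by
    intro y hy
    have hy' := (Finset.mem_filter.1 hy).2
    obtain ⟨ψ, hψ, h⟩ := exists_cover_of_not_scattered hl (fun i => cell (y i)) hy' Q
      fun i => hQ _
    refine Finset.mem_biUnion.2 ⟨ψ, hψ, Finset.mem_biUnion.2
      ⟨Finset.univ.filter fun i => l < load (fun i => cell (y i)) i, ?_, ?_⟩⟩
    · simp only [Scattered, not_le, Fintype.card_fin] at hy'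
      exact Finset.mem_filter.2 ⟨Finset.mem_univ _, hy'.le⟩
    · rw [Fintype.mem_piFinset]
      intro i
      split_ifs with hi
      · simpa using h i hi
      · simp
  have hl' : (0 : ℝ) < l := by exact_mod_cast hl
  have hfib : ∀ ψ : Fin (q / l) → P,
      ((Finset.univ.filter fun z => ∃ a, ψ a = cell z).card : ℝ) ≤ Fintype.card Ω * (1 / l) := by
    intro ψ
    have h1 : (Finset.univ.filter fun z => ∃ a, ψ a = cell z) ⊆
        Finset.univ.biUnion fun a => Finset.univ.filter fun z => cell z = ψ a := by
      intro z hz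
      obtain ⟨a, ha⟩ := (Finset.mem_filter.1 hz).2
      exact Finset.mem_biUnion.2 ⟨a, Finset.mem_univ _, by simp [ha]⟩
    have h2 := (Finset.card_le_card h1).trans Finset.card_biUnion_le
    rw [mul_one_div, le_div_iff₀ hl']
    rcases Nat.eq_zero_or_pos q with rfl | hq
    · have : (Finset.univ.filter fun z => ∃ a, ψ a = cell z) = ∅ :=
        Finset.filter_eq_empty_iff.2 fun z _ ⟨a, _⟩ => by simpa using a.2
      rw [this]
      simp
    have h3 : q * (Finset.univ.filter fun z => ∃ a, ψ a = cell z).card ≤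
        q / l * Fintype.card Ω := by
      calc _ ≤ ∑ a : Fin (q / l), q * (Finset.univ.filter fun z => cell z = ψ a).card := by
            rw [← Finset.mul_sum]; exact Nat.mul_le_mul_left _ h2
        _ ≤ ∑ a : Fin (q / l), Fintype.card Ω := Finset.sum_le_sum fun a _ => hcell _
        _ = _ := by simp
    have h4 : q * ((Finset.univ.filter fun z => ∃ a, ψ a = cell z).card * l) ≤
        q * Fintype.card Ω := by
      calc _ = q * (Finset.univ.filter fun z => ∃ a, ψ a = cell z).card * l := by ring
        _ ≤ q / l * Fintype.card Ω * l := Nat.mul_le_mul_right _ h3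
        _ = (q / l * l) * Fintype.card Ω := by ring
        _ ≤ _ := Nat.mul_le_mul_right _ (Nat.div_mul_le_self q l)
    exact_mod_cast Nat.le_of_mul_le_mul_left h4 hq
  have hW : ∀ ψ, ∀ F ∈ 𝓕, ((W ψ F).card : ℝ) ≤ (1 / √l) ^ q * (Fintype.card Ω : ℝ) ^ q := by
    intro ψ F hF
    have hF' := (Finset.mem_filter.1 hF).2
    rw [Fintype.card_piFinset]
    push_cast
    have hl1 : (1 : ℝ) ≤ l := by exact_mod_cast hl
    calc ∏ i, ((if i ∈ F then Finset.univ.filter fun z => ∃ a, ψ a = cell z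
          else Finset.univ : Finset Ω).card : ℝ)
        ≤ ∏ i : Fin q, ((Fintype.card Ω : ℝ) * if i ∈ F then 1 / (l : ℝ) else 1) := by
          refine Finset.prod_le_prod (fun i _ => by positivity) fun i _ => ?_
          split_ifs
          · exact hfib ψ
          · simp
      _ = (Fintype.card Ω : ℝ) ^ q * (1 / l) ^ F.card := by
          rw [Finset.prod_mul_distrib]
          simp [Finset.prod_ite_mem]
      _ = (Fintype.card Ω : ℝ) ^ q * (1 / √l) ^ (2 * F.card) := by
          rw [pow_mul, div_pow 1 √(l : ℝ) 2, Real.sq_sqrt hl'.le, one_pow]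
      _ ≤ (Fintype.card Ω : ℝ) ^ q * (1 / √l) ^ q := by
          gcongr ?_ * ?_
          refine pow_le_pow_of_le_one (by positivity) ?_ hF'
          rw [div_le_one (Real.sqrt_pos.2 hl')]
          exact Real.one_le_sqrt.2 hl1
      _ = _ := mul_comm _ _
  rw [Nat.card_eq_fintype_card, Fintype.card_subtype]
  calc ((Finset.univ.filter fun y : Fin q → Ω => ¬ Scattered l fun i => cell (y i)).card : ℝ)
      ≤ ∑ ψ ∈ Ψ, ∑ F ∈ 𝓕, ((W ψ F).card : ℝ) := by
        exact_mod_cast (Finset.card_le_card hsub).trans (Finset.card_biUnion_le.trans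
          (Finset.sum_le_sum fun ψ _ => Finset.card_biUnion_le))
    _ ≤ ∑ ψ ∈ Ψ, ∑ F ∈ 𝓕, (1 / √l) ^ q * (Fintype.card Ω : ℝ) ^ q :=
        Finset.sum_le_sum fun ψ _ => Finset.sum_le_sum fun F hF => hW ψ F hF
    _ = (Q.card : ℝ) ^ (q / l) * (𝓕.card * ((1 / √l) ^ q * (Fintype.card Ω : ℝ) ^ q)) := by
        simp [Ψ, Fintype.card_piFinset]
    _ ≤ (Q.card : ℝ) ^ (q / l) * (2 ^ q * ((1 / √l) ^ q * (Fintype.card Ω : ℝ) ^ q)) := by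
        gcongr
        have := Finset.card_le_univ 𝓕
        simp only [Fintype.card_finset, Fintype.card_fin] at this
        exact_mod_cast this
    _ = _ := by ring

end Crowding

/-! ### Collisions when the rows are revealed digit by digit. -/

section Revealing

variable {I P : Type} [Fintype I] [DecidableEq I] [DecidableEq P]

/-- Choose a partner in `C i` for each `i ∈ F`. Partners lie outside `F`, so the values off `F` then
determine `d`. -/
theorem card_repeating_le (F : Finset I) (C : I → Finset I) (hC : ∀ i ∈ F, Disjoint (C i) F)
    {K D : ℕ} (hK : ∀ i ∈ F, (C i).card ≤ K) :
    (Finset.univ.filter fun d : I → Fin D => ∀ i ∈ F, ∃ j ∈ C i, d i = d j).card ≤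
      K ^ F.card * D ^ (Fintype.card I - F.card) := by
  classical
  set J := Fintype.piFinset fun i : F => C i
  have hsub : (Finset.univ.filter fun d : I → Fin D => ∀ i ∈ F, ∃ j ∈ C i, d i = d j) ⊆
      J.biUnion fun j => Finset.univ.filter fun d : I → Fin D => ∀ i : F, d i = d (j i) := by
    intro d hd
    have hd' := (Finset.mem_filter.1 hd).2
    choose j hj hdj using hd'
    refine Finset.mem_biUnion.2 ⟨fun i => j i i.2, ?_, ?_⟩
    · rw [Fintype.mem_piFinset]; exact fun i => hj i i.2
    · simp only [Finset.mem_filter, Finset.mem_univ, true_and]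
      exact fun i => hdj i i.2
  have hone : ∀ j ∈ J, (Finset.univ.filter fun d : I → Fin D => ∀ i : F, d i = d (j i)).card ≤
      D ^ (Fintype.card I - F.card) := by
    intro j hj
    rw [Fintype.mem_piFinset] at hj
    have h1 : Fintype.card ({i // i ∉ F} → Fin D) = D ^ (Fintype.card I - F.card) := by
      rw [Fintype.card_fun, Fintype.card_fin, Fintype.card_subtype_compl]
      simp
    rw [← h1, ← Finset.card_univ]
    refine Finset.card_le_card_of_injOn (fun d i => d i.1) (fun _ _ => Finset.mem_univ _) ?_
    intro d hd d' hd' heq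
    simp only [Finset.coe_filter, Finset.mem_univ, true_and, Set.mem_ofPred_eq] at hd hd'
    have hout : ∀ i, i ∉ F → d i = d' i := fun i hi => congrFun heq ⟨i, hi⟩
    funext i
    by_cases hi : i ∈ F
    · have h2 := hd ⟨i, hi⟩
      have h3 := hd' ⟨i, hi⟩
      simp only at h2 h3
      rw [h2, h3]
      exact hout _ (Finset.disjoint_left.1 (hC i hi) (hj ⟨i, hi⟩))
    · exact hout i hi
  refine (Finset.card_le_card hsub).trans (Finset.card_biUnion_le.trans
    ((Finset.sum_le_card_nsmul _ _ _ hone).trans ?_))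
  rw [smul_eq_mul, Fintype.card_piFinset]
  refine Nat.mul_le_mul_right _ ?_
  calc ∏ i : F, (C i).card ≤ ∏ _i : F, K := Finset.prod_le_prod' fun i _ => hK i i.2
    _ = K ^ F.card := by simp

/-- Few ways of assigning children to the points in cells with at most `K` points lead to `h`
collisions. -/
theorem card_colliding_le (p : I → P) (E : Finset I) {K D h : ℕ} (hKD : K ≤ D)
    (hK : ∀ i ∈ E, (E.filter fun j => p j = p i).card ≤ K) :
    (Finset.univ.filter fun d : I → Fin D =>
        (Finset.univ.image fun i => (p i, d i)).card + h ≤ E.card).card ≤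
      2 ^ Fintype.card I * (K ^ h * D ^ (Fintype.card I - h)) := by
  classical
  set 𝓕 := (Finset.univ : Finset (Finset I)).filter fun F => F ⊆ E ∧ h ≤ F.card
  set W : Finset I → Finset (I → Fin D) := fun F => Finset.univ.filter fun d =>
    ∀ i ∈ F, ∃ j ∈ (E \ F).filter (fun j => p j = p i), d i = d j
  have hsub : (Finset.univ.filter fun d : I → Fin D =>
        (Finset.univ.image fun i => (p i, d i)).card + h ≤ E.card) ⊆ 𝓕.biUnion W := by
    intro d hd
    have hd' := (Finset.mem_filter.1 hd).2
    set φ : I → P × Fin D := fun i => (p i, d i)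
    -- `R` has one representative per occupied child. The rest of `E`, at least `h` indices, repeat
    -- the child of a representative.
    obtain ⟨R, hRE, hRim, hRinj⟩ : ∃ R ⊆ E, R.image φ = E.image φ ∧ Set.InjOn φ R := by
      obtain ⟨R, hR, hbij⟩ := Set.SurjOn.exists_bijOn_subset
        (Set.surjOn_image φ (E : Set I))
      have hRfin : R.Finite := E.finite_toSet.subset hR
      refine ⟨hRfin.toFinset, by simpa using hR, ?_, by simpa using hbij.injOn⟩
      rw [← Finset.coe_inj]
      push_cast
      simpa using hbij.image_eq
    have hRcard : R.card ≤ (Finset.univ.image φ).card := by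
      rw [← Finset.card_image_of_injOn hRinj]
      exact Finset.card_le_card (Finset.image_subset_image (Finset.subset_univ _))
    refine Finset.mem_biUnion.2 ⟨E \ R, ?_, ?_⟩
    · refine Finset.mem_filter.2 ⟨Finset.mem_univ _, Finset.sdiff_subset, ?_⟩
      rw [Finset.card_sdiff_of_subset hRE]
      omega
    · refine Finset.mem_filter.2 ⟨Finset.mem_univ _, fun i hi => ?_⟩
      have : φ i ∈ R.image φ := by
        rw [hRim]; exact Finset.mem_image_of_mem φ (Finset.mem_sdiff.1 hi).1
      obtain ⟨j, hj, hji⟩ := Finset.mem_image.1 this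
      simp only [φ, Prod.mk.injEq] at hji
      refine ⟨j, ?_, hji.2.symm⟩
      simp [hRE hj, hj, hji.1]
  have hW : ∀ F ∈ 𝓕, (W F).card ≤ K ^ h * D ^ (Fintype.card I - h) := by
    intro F hF
    obtain ⟨hFE, hFh⟩ := (Finset.mem_filter.1 hF).2
    refine (card_repeating_le F _ (fun i _ => ?_) (fun i hi => ?_)).trans
      (b := K ^ F.card * D ^ (Fintype.card I - F.card)) ?_
    · exact (Finset.disjoint_sdiff.symm.mono_left (Finset.filter_subset _ _))
    · exact (Finset.card_le_card (Finset.filter_subset_filter _ Finset.sdiff_subset)).trans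
        (hK i (hFE hi))
    · have hFI : F.card ≤ Fintype.card I := Finset.card_le_univ F
      obtain ⟨e, he⟩ := Nat.exists_eq_add_of_le hFh
      obtain ⟨g, hg⟩ := Nat.exists_eq_add_of_le hFI
      have h1 : Fintype.card I - F.card = g := by omega
      have h2 : Fintype.card I - h = e + g := by omega
      rw [h1, h2, he, pow_add, pow_add, mul_assoc]
      gcongr
  refine (Finset.card_le_card hsub).trans (Finset.card_biUnion_le.trans
    ((Finset.sum_le_card_nsmul _ _ _ hW).trans ?_))
  rw [smul_eq_mul]
  refine Nat.mul_le_mul_right _ ?_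
  simpa using Finset.card_le_univ 𝓕

/-- In the grid with columns `a` and rows `w`, obtained by merging rows in groups of `D`, half of
the points lie in cells with at most `K` of them, but the original grid has fewer than `h`
occupied cells. -/
def Clumped (D K h : ℕ) (a : I → ℕ) (w : I → ℕ) : Prop :=
  (∃ E : Finset I, 2 * h ≤ E.card ∧
    ∀ i ∈ E, (E.filter fun j => (a j, w j / D) = (a i, w i / D)).card ≤ K) ∧
  (Finset.univ.image fun i => (a i, w i)).card < h

/-- Given the coarse rows `w'`, only the last base-`D` digits remain, and these are the assignment
of children in `card_colliding_le`. -/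
theorem card_clumped_fiber_le {D K h : ℕ} (hD : 0 < D) (hKD : K ≤ D) (a : I → ℕ) (w' : I → ℕ)
    (W : Finset (I → ℕ)) (hW : ∀ w ∈ W, Clumped D K h a w ∧ (fun i => w i / D) = w') :
    W.card ≤ 2 ^ Fintype.card I * (K ^ h * D ^ (Fintype.card I - h)) := by
  classical
  rcases W.eq_empty_or_nonempty with rfl | ⟨w₀, hw₀⟩
  · simp
  -- The condition on `E` involves only the coarse rows, so the `E` of one member of `W` serves for
  -- all.
  obtain ⟨⟨⟨E, hE, hEK⟩, -⟩, hw₀'⟩ := hW w₀ hw₀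
  refine le_trans ?_ (card_colliding_le (D := D) (h := h) (fun i => (a i, w' i)) E hKD
    (by simpa only [← hw₀'] using hEK))
  refine Finset.card_le_card_of_injOn (fun w i => ⟨w i % D, Nat.mod_lt _ hD⟩) ?_ ?_
  · intro w hw
    obtain ⟨⟨-, hlt⟩, hw'⟩ := hW w hw
    simp only [Finset.coe_filter, Finset.mem_univ, true_and, Set.mem_ofPred_eq]
    have : (Finset.univ.image fun i => ((a i, w' i), (⟨w i % D, Nat.mod_lt _ hD⟩ : Fin D))).card ≤
        (Finset.univ.image fun i => (a i, w i)).card := by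
      have h2 : (Finset.univ.image fun i => ((a i, w' i), (⟨w i % D, Nat.mod_lt _ hD⟩ : Fin D))) =
          (Finset.univ.image fun i => (a i, w i)).image fun c =>
            ((c.1, c.2 / D), (⟨c.2 % D, Nat.mod_lt _ hD⟩ : Fin D)) := by
        rw [Finset.image_image]
        congr 1
        funext i
        simp [← hw']
      rw [h2]
      exact Finset.card_image_le
    omega
  · intro w hw v hv heq
    funext i
    have h1 := congrFun (hW w hw).2 i
    have h2 := congrFun (hW v hv).2 i
    have h3 := congrArg Fin.val (congrFun heq i)
    simp only at h1 h2 h3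
    rw [← Nat.div_add_mod (w i) D, ← Nat.div_add_mod (v i) D, h1, h2, h3]

/-- The digits are revealed from the most significant down; each scale restricts its own digit given
the higher ones, so the bounds multiply. The columns may change with the scale because they do not
depend on `v`. -/
theorem card_image_clumped_le {n D K h : ℕ} (hD : 0 < D) (hKD : K ≤ D) (a : ℕ → I → ℕ) (T : ℕ) :
    ∀ (s₀ : ℕ) (W : Finset (I → Fin n)),
      (∀ v ∈ W, ∀ s, s₀ ≤ s → s < s₀ + T → Clumped D K h (a s) fun i => v i / D ^ s) →
      (W.image fun v i => (v i : ℕ) / D ^ s₀).card ≤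
        (n / D ^ (s₀ + T) + 1) ^ Fintype.card I *
          (2 ^ Fintype.card I * (K ^ h * D ^ (Fintype.card I - h))) ^ T := by
  induction T with
  | zero =>
    intro s₀ W _
    have : (W.image fun v i => (v i : ℕ) / D ^ s₀) ⊆
        Fintype.piFinset fun _ : I => Finset.range (n / D ^ s₀ + 1) := by
      intro w hw
      obtain ⟨v, _, rfl⟩ := Finset.mem_image.1 hw
      rw [Fintype.mem_piFinset]
      intro i
      rw [Finset.mem_range, Nat.lt_succ_iff]
      exact Nat.div_le_div_right (v i).2.le
    refine (Finset.card_le_card this).trans ?_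
    simp [Fintype.card_piFinset]
  | succ T ih =>
    intro s₀ W hW
    have h1 := ih (s₀ + 1) W fun v hv s hs hs' => hW v hv s (by omega) (by omega)
    have hmaps : ∀ w ∈ W.image fun v i => (v i : ℕ) / D ^ s₀,
        (fun i => w i / D) ∈ W.image fun v i => (v i : ℕ) / D ^ (s₀ + 1) := by
      intro w hw
      obtain ⟨v, hv, rfl⟩ := Finset.mem_image.1 hw
      refine Finset.mem_image.2 ⟨v, hv, ?_⟩
      funext i
      rw [Nat.div_div_eq_div_mul, pow_succ]
    have h2 := Finset.card_le_mul_card_image_of_maps_to hmaps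
      (2 ^ Fintype.card I * (K ^ h * D ^ (Fintype.card I - h))) (by
        intro w' _
        refine card_clumped_fiber_le hD hKD (a s₀) w' _ ?_
        intro w hw
        obtain ⟨hw1, hw2⟩ := Finset.mem_filter.1 hw
        obtain ⟨v, hv, rfl⟩ := Finset.mem_image.1 hw1
        exact ⟨hW v hv s₀ le_rfl (by omega), hw2⟩)
    refine h2.trans ((Nat.mul_le_mul_left _ h1).trans (le_of_eq ?_))
    rw [show s₀ + 1 + T = s₀ + (T + 1) by ring]
    ring

/-- Few rows lead to few occupied cells on `T` consecutive scales. -/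
theorem card_clumped_le {n D K h : ℕ} (hD : 0 < D) (hKD : K ≤ D) (a : ℕ → I → ℕ) (s₀ T : ℕ)
    (hn : D ^ (s₀ + T) ≤ n) (W : Finset (I → Fin n))
    (hW : ∀ v ∈ W, ∀ s, s₀ ≤ s → s < s₀ + T → Clumped D K h (a s) fun i => v i / D ^ s) :
    W.card * (D ^ T) ^ Fintype.card I ≤ (2 * n) ^ Fintype.card I *
      (2 ^ Fintype.card I * (K ^ h * D ^ (Fintype.card I - h))) ^ T := by
  have h1 := card_image_clumped_le (n := n) (K := K) (h := h) hD hKD a T s₀ W hW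
  -- The digits below `s₀` are free.
  have h2 : W.card ≤ (D ^ s₀) ^ Fintype.card I * (W.image fun v i => (v i : ℕ) / D ^ s₀).card := by
    refine Finset.card_le_mul_card_image W _ fun w _ => ?_
    have : Fintype.card (I → Fin (D ^ s₀)) = (D ^ s₀) ^ Fintype.card I := by simp
    rw [← this, ← Finset.card_univ]
    refine Finset.card_le_card_of_injOn
      (fun v i => ⟨(v i : ℕ) % D ^ s₀, Nat.mod_lt _ (pow_pos hD _)⟩)
      (fun _ _ => Finset.mem_univ _) ?_
    intro v hv v' hv' heq
    have e1 := (Finset.mem_filter.1 hv).2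
    have e2 := (Finset.mem_filter.1 hv').2
    funext i
    have h3 := congrArg Fin.val (congrFun heq i)
    have h4 := congrFun (e1.trans e2.symm) i
    simp only at h3 h4
    ext
    rw [← Nat.div_add_mod (v i : ℕ) (D ^ s₀), ← Nat.div_add_mod (v' i : ℕ) (D ^ s₀), h3, h4]
  -- The top block may be incomplete, which costs the factor `2`.
  have h3 : D ^ (s₀ + T) * (n / D ^ (s₀ + T) + 1) ≤ 2 * n := by
    have := Nat.mul_div_le n (D ^ (s₀ + T))
    nlinarith
  calc W.card * (D ^ T) ^ Fintype.card I
      ≤ (D ^ s₀) ^ Fintype.card I * ((n / D ^ (s₀ + T) + 1) ^ Fintype.card I *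
          (2 ^ Fintype.card I * (K ^ h * D ^ (Fintype.card I - h))) ^ T) *
          (D ^ T) ^ Fintype.card I :=
        Nat.mul_le_mul_right _ (h2.trans (Nat.mul_le_mul_left _ h1))
    _ = (D ^ (s₀ + T) * (n / D ^ (s₀ + T) + 1)) ^ Fintype.card I *
          (2 ^ Fintype.card I * (K ^ h * D ^ (Fintype.card I - h))) ^ T := by
        rw [pow_add D]
        generalize (2 ^ Fintype.card I * (K ^ h * D ^ (Fintype.card I - h))) ^ T = c
        generalize n / (D ^ s₀ * D ^ T) + 1 = e
        generalize D ^ s₀ = A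
        generalize D ^ T = B
        ring
    _ ≤ _ := Nat.mul_le_mul_right _ (Nat.pow_le_pow_left h3 _)

end Revealing

end ORC

namespace ORC

/-! ### Triangular systems from queries in distinct cells. -/

section Rank

/-- A triangular system of subset sums determines the weights at its pivots. -/
theorem card_triangular_le {α : Type} [PartialOrder α] {k n : ℕ} (J : Finset α) (j : α → Fin k)
    (hj : Set.InjOn j J) (M : α → Finset (Fin k)) (hM : ∀ h ∈ J, j h ∈ M h)
    (hM' : ∀ h ∈ J, ∀ h' ∈ J, j h' ∈ M h → h' ≤ h) (g : α → ℕ) :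
    (Finset.univ.filter fun w : Fin k → Fin n =>
      ∀ h ∈ J, ∑ i ∈ M h, ((w i : ℕ) + 1) = g h).card * n ^ J.card ≤ n ^ k := by
  classical
  have hcard : (J.image j).card = J.card := Finset.card_image_of_injOn hj
  have hle : J.card ≤ k := by
    rw [← hcard]; simpa using Finset.card_le_univ (J.image j)
  have h1 : Fintype.card ({i // i ∉ J.image j} → Fin n) = n ^ (k - J.card) := by
    rw [Fintype.card_fun, Fintype.card_fin, Fintype.card_subtype_compl, Fintype.card_fin]
    congr 2
    rw [Fintype.card_coe, hcard]
  suffices h : (Finset.univ.filter fun w : Fin k → Fin n =>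
      ∀ h ∈ J, ∑ i ∈ M h, ((w i : ℕ) + 1) = g h).card ≤ n ^ (k - J.card) by
    calc _ ≤ n ^ (k - J.card) * n ^ J.card := Nat.mul_le_mul_right _ h
      _ = n ^ k := by rw [← pow_add, Nat.sub_add_cancel hle]
  rw [← h1, ← Finset.card_univ]
  refine Finset.card_le_card_of_injOn (fun w i => w i.1) (fun _ _ => Finset.mem_univ _) ?_
  intro w hw w' hw' heq
  simp only [Finset.coe_filter, Finset.mem_univ, true_and, Set.mem_ofPred_eq] at hw hw'
  have hout : ∀ i, i ∉ J.image j → w i = w' i := fun i hi => congrFun heq ⟨i, hi⟩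
  have hin : ∀ h ∈ J, w (j h) = w' (j h) := by
    by_contra! hcon
    obtain ⟨h₀, hh₀, hne₀⟩ := hcon
    -- In the equation of a minimal `h` at whose pivot the solutions differ, every other pivot
    -- belongs to some `h' < h`, so all other weights agree.
    obtain ⟨h, hmem, hmin⟩ := (J.filter fun h => w (j h) ≠ w' (j h)).exists_minimal
      ⟨h₀, Finset.mem_filter.2 ⟨hh₀, hne₀⟩⟩
    obtain ⟨hhJ, hne⟩ := Finset.mem_filter.1 hmem
    have hrest : ∑ i ∈ (M h).erase (j h), ((w i : ℕ) + 1) =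
        ∑ i ∈ (M h).erase (j h), ((w' i : ℕ) + 1) := by
      refine Finset.sum_congr rfl fun i hi => ?_
      obtain ⟨hij, hiM⟩ := Finset.mem_erase.1 hi
      have : w i = w' i := by
        by_cases hiJ : i ∈ J.image j
        · obtain ⟨h', hh', rfl⟩ := Finset.mem_image.1 hiJ
          by_contra hne'
          have hle' := hM' h hhJ h' hh' hiM
          have := hmin (Finset.mem_filter.2 ⟨hh', hne'⟩) hle'
          exact hij (congrArg j (le_antisymm hle' this))
        · exact hout i hiJ
      rw [this]
    have e1 := hw h hhJ
    have e2 := hw' h hhJ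
    rw [← Finset.add_sum_erase _ _ (hM h hhJ)] at e1 e2
    rw [hrest] at e1
    apply hne
    ext
    omega
  funext i
  by_cases hi : i ∈ J.image j
  · obtain ⟨h, hh, rfl⟩ := Finset.mem_image.1 hi
    exact hin h hh
  · exact hout i hi

/-- A set of cells contains a large subset of one parity class avoiding the boundary. -/
theorem exists_parity_class (H : Finset (ℕ × ℕ)) {a b : ℕ} (hH : ∀ h ∈ H, h.1 < a ∧ h.2 < b) :
    ∃ H' ⊆ H, (∀ h ∈ H', 1 ≤ h.1 ∧ 1 ≤ h.2) ∧
      (∀ h ∈ H', ∀ h' ∈ H', h.1 % 2 = h'.1 % 2 ∧ h.2 % 2 = h'.2 % 2) ∧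
      H.card ≤ 4 * H'.card + a + b := by
  classical
  set H₁ := H.filter fun h => 1 ≤ h.1 ∧ 1 ≤ h.2
  have h1 : H.card ≤ H₁.card + a + b := by
    have hsub : H ⊆ H₁ ∪ ((Finset.range a).image fun i => (i, 0)) ∪
        ((Finset.range b).image fun i => (0, i)) := by
      intro h hh
      obtain ⟨h2, h3⟩ := hH h hh
      simp only [Finset.mem_union, Finset.mem_image, Finset.mem_range]
      by_cases h4 : h.2 = 0
      · exact Or.inl (Or.inr ⟨h.1, h2, by rw [← h4]⟩)
      by_cases h5 : h.1 = 0
      · exact Or.inr ⟨h.2, h3, by rw [← h5]⟩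
      · exact Or.inl (Or.inl (Finset.mem_filter.2 ⟨hh, by omega⟩))
    refine (Finset.card_le_card hsub).trans ((Finset.card_union_le _ _).trans ?_)
    refine add_le_add ((Finset.card_union_le _ _).trans (add_le_add le_rfl ?_)) ?_
    · exact Finset.card_image_le.trans (by simp)
    · exact Finset.card_image_le.trans (by simp)
  set T := Finset.range 2 ×ˢ Finset.range 2 with hT
  have hmaps : ∀ h ∈ H₁, (h.1 % 2, h.2 % 2) ∈ T := fun h _ => by
    simp only [hT, Finset.mem_product, Finset.mem_range]
    omega
  obtain ⟨c, -, hc⟩ : ∃ c ∈ T, H₁.card ≤ 4 * (H₁.filter fun h => (h.1 % 2, h.2 % 2) = c).card := by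
    by_contra! hcon
    have h2 := Finset.card_eq_sum_card_fiberwise (f := fun h : ℕ × ℕ => (h.1 % 2, h.2 % 2)) hmaps
    have h3 : ∑ c ∈ T, 4 * (H₁.filter fun h => (h.1 % 2, h.2 % 2) = c).card <
        ∑ c ∈ T, H₁.card := Finset.sum_lt_sum_of_nonempty (by simp [hT]) hcon
    rw [← Finset.mul_sum, ← h2] at h3
    simp [hT] at h3
  refine ⟨H₁.filter fun h => (h.1 % 2, h.2 % 2) = c,
    (Finset.filter_subset _ _).trans (Finset.filter_subset _ _), ?_, ?_, by omega⟩
  · intro h hh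
    exact (Finset.mem_filter.1 (Finset.mem_filter.1 hh).1).2
  · intro h hh h' hh'
    have e := (Finset.mem_filter.1 hh).2.trans (Finset.mem_filter.1 hh').2.symm
    exact Prod.mk.inj e

/-- The points of the cell diagonally below the cell `h` of the grid with mesh `U × V`. -/
def cellBelow (n U V : ℕ) (h : ℕ × ℕ) : Finset (Point n) :=
  Finset.univ.filter fun p => (p.1 : ℕ) / U + 1 = h.1 ∧ (p.2 : ℕ) / V + 1 = h.2

variable {n U V : ℕ}

theorem le_of_mem_cellBelow {h : ℕ × ℕ} {p z : Point n}
    (hp : p ∈ cellBelow n U V h) (hz : ((z.1 : ℕ) / U, (z.2 : ℕ) / V) = h) : p ≤ z := by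
  obtain ⟨-, h1, h2⟩ := Finset.mem_filter.1 hp
  subst hz
  simp only at h1 h2
  refine ⟨Fin.le_def.2 ?_, Fin.le_def.2 ?_⟩
  · by_contra! hlt
    have := Nat.div_le_div_right (c := U) hlt.le
    omega
  · by_contra! hlt
    have := Nat.div_le_div_right (c := V) hlt.le
    omega

/-- Dominance alone gives `h' ≤ h + (1, 1)`; equal parities exclude the excess. This is the purpose
of the parity class: it makes the system triangular. -/
theorem le_of_cellBelow_le {h h' : ℕ × ℕ} {p z : Point n}
    (hp : p ∈ cellBelow n U V h') (hz : ((z.1 : ℕ) / U, (z.2 : ℕ) / V) = h) (hpz : p ≤ z)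
    (hpar : h.1 % 2 = h'.1 % 2 ∧ h.2 % 2 = h'.2 % 2) : h' ≤ h := by
  obtain ⟨-, h1, h2⟩ := Finset.mem_filter.1 hp
  have e1 := Nat.div_le_div_right (c := U) (Fin.le_def.1 hpz.1)
  have e2 := Nat.div_le_div_right (c := V) (Fin.le_def.1 hpz.2)
  subst hz
  simp only at h1 h2 hpar
  exact ⟨by simp only; omega, by simp only; omega⟩

theorem cellBelow_disjoint {h h' : ℕ × ℕ} {p : Point n} (hp : p ∈ cellBelow n U V h)
    (hp' : p ∈ cellBelow n U V h') : h = h' := by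
  obtain ⟨-, h1, h2⟩ := Finset.mem_filter.1 hp
  obtain ⟨-, h1', h2'⟩ := Finset.mem_filter.1 hp'
  exact Prod.ext (by omega) (by omega)

/-- Cells at the upper border may be truncated, but one diagonally below an occupied cell is
complete. -/
theorem card_cellBelow (hU : 0 < U) (hV : 0 < V) {h : ℕ × ℕ} {z : Point n} (h1 : 1 ≤ h.1)
    (h2 : 1 ≤ h.2) (hz : ((z.1 : ℕ) / U, (z.2 : ℕ) / V) = h) :
    U * V ≤ (cellBelow n U V h).card := by
  subst hz
  simp only at h1 h2
  have hU' : (z.1 : ℕ) / U * U ≤ z.1 := Nat.div_mul_le_self _ _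
  have hV' : (z.2 : ℕ) / V * V ≤ z.2 := Nat.div_mul_le_self _ _
  obtain ⟨a, ha⟩ := Nat.exists_eq_add_of_le' h1
  obtain ⟨b, hb⟩ := Nat.exists_eq_add_of_le' h2
  rw [ha, add_mul, one_mul] at hU'
  rw [hb, add_mul, one_mul] at hV'
  have hz1 := z.1.2
  have hz2 := z.2.2
  have : Fintype.card (Fin U × Fin V) = U * V := by simp
  rw [← this, ← Finset.card_univ]
  refine Finset.card_le_card_of_injOn
    (fun c => (⟨a * U + c.1, by have := c.1.2; omega⟩, ⟨b * V + c.2, by have := c.2.2; omega⟩))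
    ?_ ?_
  · intro c _
    simp only [cellBelow, Finset.coe_filter, Finset.mem_univ, true_and, Set.mem_ofPred_eq, ha, hb]
    constructor
    · rw [mul_comm, Nat.mul_add_div hU, Nat.div_eq_of_lt c.1.2]
    · rw [mul_comm, Nat.mul_add_div hV, Nat.div_eq_of_lt c.2.2]
  · rintro c - c' - heq
    simp only [Prod.mk.injEq, Fin.mk.injEq] at heq
    exact Prod.ext (Fin.ext (by omega)) (Fin.ext (by omega))

/-- Rarely are half of the given disjoint cells missed by `k` random points. -/
theorem card_missing_le {Ω α : Type} [Fintype Ω] [DecidableEq Ω] [DecidableEq α] (k : ℕ)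
    (H : Finset α) (C : α → Finset Ω) (hdisj : (H : Set α).PairwiseDisjoint C) {c : ℕ}
    (hC : ∀ h ∈ H, c ≤ (C h).card) (hΩ : 0 < Fintype.card Ω) :
    ((Finset.univ.filter fun l : Fin k → Ω =>
      2 * (H.filter fun h => ∃ j, l j ∈ C h).card < H.card).card : ℝ) ≤
      2 ^ H.card * ((Fintype.card Ω : ℝ) ^ k *
        Real.exp (-(k * (H.card * c / (2 * Fintype.card Ω))))) := by
  set 𝓕 := H.powerset.filter fun F => H.card ≤ 2 * F.card
  set W : Finset α → Finset (Fin k → Ω) := fun F =>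
    Fintype.piFinset fun _ => (F.biUnion C)ᶜ
  have hsub : (Finset.univ.filter fun l : Fin k → Ω =>
      2 * (H.filter fun h => ∃ j, l j ∈ C h).card < H.card) ⊆ 𝓕.biUnion W := by
    intro l hl
    have hl' := (Finset.mem_filter.1 hl).2
    refine Finset.mem_biUnion.2 ⟨H.filter fun h => ¬ ∃ j, l j ∈ C h, ?_, ?_⟩
    · refine Finset.mem_filter.2 ⟨Finset.mem_powerset.2 (Finset.filter_subset _ _), ?_⟩
      have := Finset.card_filter_add_card_filter_not (s := H) fun h => ∃ j, l j ∈ C h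
      omega
    · rw [Fintype.mem_piFinset]
      intro j
      simp only [Finset.mem_compl, Finset.mem_biUnion, not_exists, not_and]
      intro h hh hj
      exact (Finset.mem_filter.1 hh).2 j hj
  have hΩ' : (0 : ℝ) < Fintype.card Ω := by exact_mod_cast hΩ
  have hW : ∀ F ∈ 𝓕, ((W F).card : ℝ) ≤ (Fintype.card Ω : ℝ) ^ k *
        Real.exp (-(k * (H.card * c / (2 * Fintype.card Ω)))) := by
    intro F hF
    obtain ⟨hFH, hF2⟩ := Finset.mem_filter.1 hF
    rw [Finset.mem_powerset] at hFH
    have h1 : F.card * c ≤ (F.biUnion C).card := by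
      rw [Finset.card_biUnion fun a ha b hb hab => hdisj (hFH ha) (hFH hb) hab]
      simpa using Finset.card_nsmul_le_sum F (fun h => (C h).card) c fun h hh => hC h (hFH hh)
    have h2 : H.card * c ≤ 2 * (F.biUnion C).card := by nlinarith
    have h3 : (((F.biUnion C)ᶜ.card : ℕ) : ℝ) = Fintype.card Ω - (F.biUnion C).card := by
      rw [Finset.card_compl, Nat.cast_sub (Finset.card_le_univ _)]
    have h4 : (H.card : ℝ) * c ≤ 2 * (F.biUnion C).card := by exact_mod_cast h2
    have h5 : (((F.biUnion C)ᶜ.card : ℕ) : ℝ) ≤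
        Fintype.card Ω * Real.exp (-(H.card * c / (2 * Fintype.card Ω))) := by
      have h6 := Real.add_one_le_exp (-((H.card : ℝ) * c / (2 * Fintype.card Ω)))
      calc _ ≤ (Fintype.card Ω : ℝ) * (-((H.card : ℝ) * c / (2 * Fintype.card Ω)) + 1) := by
            rw [h3]
            field_simp
            linarith
        _ ≤ _ := mul_le_mul_of_nonneg_left h6 hΩ'.le
    rw [Fintype.card_piFinset_const, Nat.cast_pow]
    refine (pow_le_pow_left₀ (Nat.cast_nonneg _) h5 k).trans (le_of_eq ?_)
    rw [mul_pow, ← Real.exp_nat_mul, mul_neg]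
  calc _ ≤ ∑ F ∈ 𝓕, ((W F).card : ℝ) := by
        exact_mod_cast (Finset.card_le_card hsub).trans Finset.card_biUnion_le
    _ ≤ 𝓕.card * ((Fintype.card Ω : ℝ) ^ k *
        Real.exp (-(k * (H.card * c / (2 * Fintype.card Ω))))) := by
        rw [← nsmul_eq_mul]
        exact Finset.sum_le_card_nsmul _ _ _ hW
    _ ≤ _ := by
        gcongr
        have := (Finset.card_filter_le H.powerset fun F => H.card ≤ 2 * F.card)
        rw [Finset.card_powerset] at this
        exact_mod_cast this

/-- If the queries `z` occupy many cells of a grid, few inputs of Alice have prescribed answers. -/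
theorem card_answers_le {I : Type} [Fintype I] (k : ℕ) (hn : 0 < n) (hU : 0 < U) (hV : 0 < V)
    (z : I → Point n) (H : Finset (ℕ × ℕ))
    (hH : ∀ h ∈ H, ∃ i, (((z i).1 : ℕ) / U, ((z i).2 : ℕ) / V) = h)
    (hpos : ∀ h ∈ H, 1 ≤ h.1 ∧ 1 ≤ h.2)
    (hpar : ∀ h ∈ H, ∀ h' ∈ H, h.1 % 2 = h'.1 % 2 ∧ h.2 % 2 = h'.2 % 2) (g : I → ℕ) :
    ((Finset.univ.filter fun x : AliceInput k n =>
      ∀ i, ∑ j ∈ Finset.univ.filter (fun j => (x j).1 ≤ z i), (((x j).2 : ℕ) + 1) = g i).card : ℝ) ≤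
      (2 ^ H.card * Real.exp (-(k * (H.card * (U * V) / (2 * n ^ 2)))) +
        (1 / √(n : ℝ)) ^ H.card) * Fintype.card (AliceInput k n) := by
  classical
  set A := Finset.univ.filter fun x : AliceInput k n =>
      ∀ i, ∑ j ∈ Finset.univ.filter (fun j => (x j).1 ≤ z i), (((x j).2 : ℕ) + 1) = g i with hA
  set Bd := Finset.univ.filter fun l : Fin k → Point n =>
      2 * (H.filter fun h => ∃ j, l j ∈ cellBelow n U V h).card < H.card with hBd
  set Wt : (Fin k → Point n) → Finset (Fin k → Fin n) := fun l => Finset.univ.filter fun w =>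
    ∀ i, ∑ j ∈ Finset.univ.filter (fun j => l j ≤ z i), ((w j : ℕ) + 1) = g i
  have hn' : (0 : ℝ) < n := by exact_mod_cast hn
  have hn1 : (1 : ℝ) ≤ n := by exact_mod_cast hn
  have hcardX : (Fintype.card (AliceInput k n) : ℝ) = ((n : ℝ) ^ 2) ^ k * (n : ℝ) ^ k := by
    simp only [Fintype.card_fun, Fintype.card_prod, Fintype.card_fin, Nat.cast_pow, Nat.cast_mul]
    rw [mul_pow]; ring
  have hAcard : A.card = ∑ l : Fin k → Point n, (Wt l).card := by
    rw [← Finset.card_sigma]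
    refine Finset.card_bij' (fun x _ => ⟨fun j => (x j).1, fun j => (x j).2⟩)
      (fun p _ j => (p.1 j, p.2 j)) ?_ ?_ ?_ ?_
    · intro x hx
      simpa [Wt, hA] using hx
    · intro p hp
      simpa [Wt, hA] using hp
    · intros; rfl
    · intros; rfl
  have hWt : ∀ l, ((Wt l).card : ℝ) ≤ n ^ k := by
    intro l
    have := Finset.card_le_univ (Wt l)
    simp only [Fintype.card_fun, Fintype.card_fin] at this
    exact_mod_cast this
  have hWt' : ∀ l, l ∉ Bd → ((Wt l).card : ℝ) ≤ (1 / √(n : ℝ)) ^ H.card * n ^ k := by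
    intro l hl
    have hl' : H.card ≤ 2 * (H.filter fun h => ∃ j, l j ∈ cellBelow n U V h).card := by
      simpa [hBd] using hl
    set J := H.filter fun h => ∃ j, l j ∈ cellBelow n U V h with hJ
    -- A member of `J` supplies default values for the choice function `φ`.
    rcases J.eq_empty_or_nonempty with hJe | ⟨h₀, hh₀⟩
    · rw [hJe] at hl'
      have : H.card = 0 := by simpa using hl'
      rw [this, pow_zero, one_mul]
      exact hWt l
    obtain ⟨j₀, -⟩ := (Finset.mem_filter.1 hh₀).2
    obtain ⟨i₀, -⟩ := hH h₀ (Finset.mem_filter.1 hh₀).1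
    have hch : ∀ h : ℕ × ℕ, ∃ p : Fin k × I, h ∈ J → l p.1 ∈ cellBelow n U V h ∧
        (((z p.2).1 : ℕ) / U, ((z p.2).2 : ℕ) / V) = h := by
      intro h
      by_cases hh : h ∈ J
      · obtain ⟨hhH, j, hj⟩ := Finset.mem_filter.1 hh
        obtain ⟨i, hi⟩ := hH h hhH
        exact ⟨(j, i), fun _ => ⟨hj, hi⟩⟩
      · exact ⟨(j₀, i₀), fun h' => absurd h' hh⟩
    choose φ hφ using hch
    -- The equation of `h` is that of a query in `h`; its pivot is a point of Alice in the cell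
    -- below.
    have h1 := card_triangular_le (n := n) J (fun h => (φ h).1) (fun h hh h' hh' heq => by
        have e1 := (hφ h hh).1
        have e2 := (hφ h' hh').1
        simp only at heq
        rw [heq] at e1
        exact cellBelow_disjoint e1 e2)
      (fun h => Finset.univ.filter fun j => l j ≤ z (φ h).2)
      (fun h hh => by simpa using le_of_mem_cellBelow (hφ h hh).1 (hφ h hh).2)
      (fun h hh h' hh' hm => by
        refine le_of_cellBelow_le (hφ h' hh').1 (hφ h hh).2 (by simpa using hm) ?_
        exact hpar h (Finset.mem_filter.1 hh).1 h' (Finset.mem_filter.1 hh').1)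
      (fun h => g (φ h).2)
    have h2 : (Wt l).card * n ^ J.card ≤ n ^ k := by
      refine le_trans (Nat.mul_le_mul_right _ (Finset.card_le_card ?_)) h1
      intro w hw
      have := (Finset.mem_filter.1 hw).2
      exact Finset.mem_filter.2 ⟨Finset.mem_univ _, fun h _ => this _⟩
    have h3 : ((Wt l).card : ℝ) * (n : ℝ) ^ J.card ≤ (n : ℝ) ^ k := by exact_mod_cast h2
    have h4 : √(n : ℝ) ^ H.card ≤ (n : ℝ) ^ J.card := by
      calc √(n : ℝ) ^ H.card ≤ √(n : ℝ) ^ (2 * J.card) :=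
            pow_le_pow_right₀ (Real.one_le_sqrt.2 hn1) hl'
        _ = _ := by rw [pow_mul, Real.sq_sqrt hn'.le]
    rw [div_pow, one_pow, one_div_mul_eq_div, le_div_iff₀ (pow_pos (Real.sqrt_pos.2 hn') _)]
    exact (mul_le_mul_of_nonneg_left h4 (Nat.cast_nonneg _)).trans h3
  have hBdcard : (Bd.card : ℝ) ≤ 2 ^ H.card * (((n : ℝ) ^ 2) ^ k *
        Real.exp (-(k * (H.card * (U * V) / (2 * n ^ 2))))) := by
    have h1 := card_missing_le k H (cellBelow n U V) (c := U * V)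
      (fun h _ h' _ hne => by
        rw [Function.onFun, Finset.disjoint_left]
        exact fun p hp hp' => hne (cellBelow_disjoint hp hp'))
      (fun h hh => by
        obtain ⟨i, hi⟩ := hH h hh
        exact card_cellBelow hU hV (hpos h hh).1 (hpos h hh).2 hi)
      (by simp only [Fintype.card_prod, Fintype.card_fin]; positivity)
    have h2 : (Fintype.card (Point n) : ℝ) = (n : ℝ) ^ 2 := by
      simp only [Fintype.card_prod, Fintype.card_fin, Nat.cast_mul]; ring
    rw [h2] at h1
    push_cast at h1
    exact h1
  calc (A.card : ℝ) = ∑ l : Fin k → Point n, ((Wt l).card : ℝ) := by rw [hAcard]; push_cast; rfl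
    _ ≤ ∑ l : Fin k → Point n, ((if l ∈ Bd then (n : ℝ) ^ k else 0) +
          (1 / √(n : ℝ)) ^ H.card * n ^ k) := by
        refine Finset.sum_le_sum fun l _ => ?_
        split_ifs with h
        · exact (hWt l).trans (le_add_of_nonneg_right (by positivity))
        · rw [zero_add]; exact hWt' l h
    _ = Bd.card * (n : ℝ) ^ k + ((n : ℝ) ^ 2) ^ k * ((1 / √(n : ℝ)) ^ H.card * n ^ k) := by
        rw [Finset.sum_add_distrib, Finset.sum_ite_mem, Finset.sum_const, Finset.sum_const,
          Finset.univ_inter, nsmul_eq_mul, nsmul_eq_mul, Finset.card_univ]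
        simp only [Fintype.card_fun, Fintype.card_prod, Fintype.card_fin, Nat.cast_pow,
          Nat.cast_mul]
        rw [sq]
    _ ≤ 2 ^ H.card * (((n : ℝ) ^ 2) ^ k *
          Real.exp (-(k * (H.card * (U * V) / (2 * n ^ 2))))) * (n : ℝ) ^ k +
          ((n : ℝ) ^ 2) ^ k * ((1 / √(n : ℝ)) ^ H.card * n ^ k) := by
        gcongr
    _ = _ := by rw [hcardX]; ring

end Rank

end ORC

namespace ORC

/-! ### Grids of different scales and the queries in them. -/

section Grids

/-- The column width of the grid of scale `s`, whose cells of height `D ^ (s + 1)` contain a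
fraction of about `1 / q` of all points. -/
def colWidth (n q D s : ℕ) : ℕ := n ^ 2 / (q * D ^ (s + 1))

/-- The cell of a point in the grid with columns of width `colWidth n q D s` and rows of
height `D ^ t`. -/
def gridCell (n q D s t : ℕ) (p : Point n) : ℕ × ℕ :=
  ((p.1 : ℕ) / colWidth n q D s, (p.2 : ℕ) / D ^ t)

/-- The queries are not concentrated on few cells on any of the scales from `s₀` to `s₀ + T`. -/
def Spread (n q D l s₀ T : ℕ) (y : BobInput q n) : Prop :=
  ∀ s, s₀ ≤ s → s < s₀ + T → Scattered l fun i => gridCell n q D s (s + 1) (y i)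

variable {n q D s : ℕ}

theorem colWidth_mul_le : q * (colWidth n q D s * D ^ (s + 1)) ≤ n ^ 2 := by
  have := Nat.div_mul_le_self (n ^ 2) (q * D ^ (s + 1))
  unfold colWidth
  calc _ = n ^ 2 / (q * D ^ (s + 1)) * (q * D ^ (s + 1)) := by ring
    _ ≤ _ := this

theorem colWidth_pos (hq : 0 < q) (hqn : q ≤ n) (hD : 0 < D) (hs : D ^ (s + 1) ≤ n) :
    0 < colWidth n q D s := by
  refine Nat.div_pos ?_ (Nat.mul_pos hq (pow_pos hD _))
  rw [sq]
  exact Nat.mul_le_mul hqn hs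

theorem le_colWidth_mul (hq : 0 < q) (hqn : q ≤ n) (hD : 0 < D) (hs : D ^ (s + 1) ≤ n) :
    n ^ 2 ≤ 2 * (q * (colWidth n q D s * D ^ (s + 1))) := by
  have hpos := colWidth_pos hq hqn hD hs
  have h1 := Nat.lt_mul_div_succ (n ^ 2) (Nat.mul_pos hq (pow_pos hD (s + 1)))
  change n ^ 2 < q * D ^ (s + 1) * (colWidth n q D s + 1) at h1
  have h2 : q * D ^ (s + 1) * (colWidth n q D s + 1) ≤
      q * D ^ (s + 1) * (2 * colWidth n q D s) := Nat.mul_le_mul_left _ (by omega)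
  linarith

theorem colWidth_le (hn : n ≤ q * D ^ (s + 1)) :
    colWidth n q D s ≤ n := by
  refine Nat.div_le_of_le_mul ?_
  rw [sq]
  exact Nat.mul_le_mul_right _ hn

theorem card_interval_le (n W a : ℕ) (hW : 0 < W) :
    (Finset.univ.filter fun i : Fin n => (i : ℕ) / W = a).card ≤ W := by
  refine le_trans (Finset.card_le_card_of_injOn (t := Finset.univ)
    (fun i => (⟨(i : ℕ) % W, Nat.mod_lt _ hW⟩ : Fin W))
    (fun _ _ => Finset.mem_univ _) ?_) (Finset.card_univ.trans (Fintype.card_fin W)).le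
  intro i hi j hj h
  have h1 := (Finset.mem_filter.1 hi).2
  have h2 := (Finset.mem_filter.1 hj).2
  have h3 := congrArg Fin.val h
  simp only at h3
  ext
  rw [← Nat.div_add_mod (i : ℕ) W, ← Nat.div_add_mod (j : ℕ) W, h1, h2, h3]

theorem card_gridCell_le (hU : 0 < colWidth n q D s) (hD : 0 < D) (c : ℕ × ℕ) :
    q * (Finset.univ.filter fun p : Point n => gridCell n q D s (s + 1) p = c).card ≤ n ^ 2 := by
  refine (Nat.mul_le_mul_left _ ?_).trans (colWidth_mul_le (n := n) (q := q) (D := D) (s := s))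
  have : (Finset.univ.filter fun p : Point n => gridCell n q D s (s + 1) p = c) ⊆
      (Finset.univ.filter fun i : Fin n => (i : ℕ) / colWidth n q D s = c.1) ×ˢ
      (Finset.univ.filter fun i : Fin n => (i : ℕ) / D ^ (s + 1) = c.2) := by
    intro p hp
    have := (Finset.mem_filter.1 hp).2
    simp [← this, gridCell]
  refine (Finset.card_le_card this).trans ?_
  rw [Finset.card_product]
  exact Nat.mul_le_mul (card_interval_le _ _ _ hU) (card_interval_le _ _ _ (pow_pos hD _))

theorem gridCell_mem {t : ℕ} (p : Point n) : gridCell n q D s t p ∈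
    Finset.range (n / colWidth n q D s + 1) ×ˢ Finset.range (n / D ^ t + 1) := by
  simp only [gridCell, Finset.mem_product, Finset.mem_range, Nat.lt_succ_iff]
  exact ⟨Nat.div_le_div_right p.1.2.le, Nat.div_le_div_right p.2.2.le⟩

theorem div_add_one_mul_le {n W : ℕ} (hW : W ≤ n) : (n / W + 1) * W ≤ 2 * n := by
  have := Nat.div_mul_le_self n W
  linarith

/-- Union bound over the scales. A coarse cell has area at least `n² / (2 q)`, and incomplete rows
and columns cost a factor `4`, hence at most `8 q` cells; `hn` keeps the column width below `n`. -/
theorem card_not_spread_le {l s₀ T : ℕ} (hl : 0 < l) (hq : 0 < q) (hqn : q ≤ n) (hD : 0 < D)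
    (hT : D ^ (s₀ + T) ≤ n) (hn : n ≤ q * D ^ s₀) :
    (Nat.card {y : BobInput q n // ¬ Spread n q D l s₀ T y} : ℝ) ≤
      T * ((8 * q : ℝ) ^ (q / l) * 2 ^ q * (1 / √l) ^ q) * Fintype.card (BobInput q n) := by
  classical
  have hone : ∀ s ∈ Finset.Ico s₀ (s₀ + T),
      ((Finset.univ.filter fun y : BobInput q n =>
        ¬ Scattered l fun i => gridCell n q D s (s + 1) (y i)).card : ℝ) ≤
      (8 * q : ℝ) ^ (q / l) * 2 ^ q * (1 / √l) ^ q * Fintype.card (BobInput q n) := by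
    intro s hs
    rw [Finset.mem_Ico] at hs
    have hsn : D ^ (s + 1) ≤ n := (Nat.pow_le_pow_right hD (by omega)).trans hT
    have hns : n ≤ q * D ^ (s + 1) :=
      hn.trans (Nat.mul_le_mul_left _ (Nat.pow_le_pow_right hD (by omega)))
    have hU := colWidth_pos hq hqn hD hsn
    have hUn := colWidth_le hns
    have h1 := card_not_scattered_le (q := q) (l := l) hl (gridCell n q D s (s + 1))
      (Finset.range (n / colWidth n q D s + 1) ×ˢ Finset.range (n / D ^ (s + 1) + 1))
      gridCell_mem (fun c => by
        have := card_gridCell_le hU hD c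
        simpa [← sq] using this)
    have hQ : (Finset.range (n / colWidth n q D s + 1) ×ˢ
        Finset.range (n / D ^ (s + 1) + 1)).card ≤ 8 * q := by
      rw [Finset.card_product, Finset.card_range, Finset.card_range]
      have e1 := div_add_one_mul_le hUn
      have e2 := div_add_one_mul_le hsn
      have e3 := le_colWidth_mul hq hqn hD hsn
      have hpos : 0 < colWidth n q D s * D ^ (s + 1) := Nat.mul_pos hU (pow_pos hD _)
      refine Nat.le_of_mul_le_mul_right ?_ hpos
      calc _ = ((n / colWidth n q D s + 1) * colWidth n q D s) *
              ((n / D ^ (s + 1) + 1) * D ^ (s + 1)) := by ring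
        _ ≤ (2 * n) * (2 * n) := Nat.mul_le_mul e1 e2
        _ = 4 * n ^ 2 := by ring
        _ ≤ _ := by linarith
    rw [Nat.card_eq_fintype_card, Fintype.card_subtype] at h1
    refine h1.trans ?_
    have hcard : (Fintype.card (BobInput q n) : ℝ) = (Fintype.card (Point n) : ℝ) ^ q := by
      simp
    rw [hcard, ← mul_assoc]
    gcongr
    exact_mod_cast hQ
  rw [Nat.card_eq_fintype_card, Fintype.card_subtype]
  have hsub : (Finset.univ.filter fun y : BobInput q n => ¬ Spread n q D l s₀ T y) ⊆
      (Finset.Ico s₀ (s₀ + T)).biUnion fun s => Finset.univ.filter fun y : BobInput q n =>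
        ¬ Scattered l fun i => gridCell n q D s (s + 1) (y i) := by
    intro y hy
    have := (Finset.mem_filter.1 hy).2
    unfold Spread at this
    push Not at this
    obtain ⟨s, h1, h2, h3⟩ := this
    exact Finset.mem_biUnion.2 ⟨s, Finset.mem_Ico.2 ⟨h1, h2⟩, by simpa using h3⟩
  calc ((Finset.univ.filter fun y : BobInput q n => ¬ Spread n q D l s₀ T y).card : ℝ)
      ≤ ∑ s ∈ Finset.Ico s₀ (s₀ + T), ((Finset.univ.filter fun y : BobInput q n =>
        ¬ Scattered l fun i => gridCell n q D s (s + 1) (y i)).card : ℝ) := by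
        exact_mod_cast (Finset.card_le_card hsub).trans Finset.card_biUnion_le
    _ ≤ _ := Finset.sum_le_card_nsmul _ _ _ hone
    _ = _ := by rw [nsmul_eq_mul, Nat.card_Ico, Nat.add_sub_cancel_left]; ring

/-- The cells of the fine grid of scale `s` occupied by one of the queries. -/
def occupied (n q D s : ℕ) {m : ℕ} (Y : Fin m → BobInput q n) : Finset (ℕ × ℕ) :=
  Finset.univ.image fun i : Fin m × Fin q => gridCell n q D s s (Y i.1 i.2)

/-- `E` collects, for each `j`, the queries in coarse cells with at most `l` queries of `Y j`. These
are at least half of all `4 h` queries, and a coarse cell receives at most `l` from each of the `m`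
inputs. -/
theorem clumped_of_spread {l s₀ T m h : ℕ} (hN : m * q = 4 * h) (Y : Fin m → BobInput q n)
    (hY : ∀ j, Spread n q D l s₀ T (Y j)) (hs : s₀ ≤ s) (hs' : s < s₀ + T)
    (hocc : (occupied n q D s Y).card < h) :
    Clumped D (m * l) h (fun i : Fin m × Fin q => ((Y i.1 i.2).1 : ℕ) / colWidth n q D s)
      fun i => ((Y i.1 i.2).2 : ℕ) / D ^ s := by
  classical
  set c : Fin m → Fin q → ℕ × ℕ := fun j i => gridCell n q D s (s + 1) (Y j i) with hc
  have hcell : ∀ j i, (((Y j i).1 : ℕ) / colWidth n q D s, ((Y j i).2 : ℕ) / D ^ s / D) = c j i := by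
    intro j i
    simp only [hc, gridCell]
    rw [Nat.div_div_eq_div_mul, pow_succ]
  refine ⟨⟨Finset.univ.filter fun i : Fin m × Fin q => load (c i.1) i.2 ≤ l, ?_, ?_⟩, hocc⟩
  · have h1 : (Finset.univ.filter fun i : Fin m × Fin q => load (c i.1) i.2 ≤ l).card =
        ∑ j : Fin m, (Finset.univ.filter fun i => load (c j) i ≤ l).card := by
      rw [Finset.card_filter, Fintype.sum_prod_type]
      exact Finset.sum_congr rfl fun j _ => (Finset.card_filter _ _).symm
    have h2 : ∀ j ∈ (Finset.univ : Finset (Fin m)),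
        q ≤ 2 * (Finset.univ.filter fun i => load (c j) i ≤ l).card := by
      intro j _
      have h3 := hY j s hs hs'
      unfold Scattered at h3
      rw [Fintype.card_fin] at h3
      have h4 := Finset.card_filter_add_card_filter_not (s := (Finset.univ : Finset (Fin q)))
        fun i => load (c j) i ≤ l
      simp only [not_le, Finset.card_univ, Fintype.card_fin] at h4
      change 2 * (Finset.univ.filter fun i => l < load (c j) i).card ≤ q at h3
      omega
    have h3 := Finset.sum_le_sum h2
    rw [← Finset.mul_sum, ← h1] at h3
    simp only [Finset.sum_const, Finset.card_univ, Fintype.card_fin, smul_eq_mul] at h3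
    omega
  · intro i _
    simp only [hcell]
    have hsub : ((Finset.univ.filter fun i : Fin m × Fin q => load (c i.1) i.2 ≤ l).filter
        fun j => c j.1 j.2 = c i.1 i.2) ⊆ Finset.univ.biUnion fun a : Fin m =>
          (Finset.univ.filter fun b => load (c a) b ≤ l ∧ c a b = c i.1 i.2).image
            fun b => (a, b) := by
      rintro ⟨a, b⟩ hab
      simp only [Finset.mem_filter, Finset.mem_univ, true_and] at hab
      refine Finset.mem_biUnion.2 ⟨a, Finset.mem_univ _, Finset.mem_image.2 ⟨b, ?_, rfl⟩⟩
      simpa using hab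
    refine (Finset.card_le_card hsub).trans (Finset.card_biUnion_le.trans ?_)
    refine (Finset.sum_le_card_nsmul _ _ l fun a _ => ?_).trans (by simp)
    refine Finset.card_image_le.trans ?_
    rcases (Finset.univ.filter fun b => load (c a) b ≤ l ∧ c a b = c i.1 i.2).eq_empty_or_nonempty
      with h0 | ⟨b₀, hb₀⟩
    · rw [h0]; simp
    · obtain ⟨-, h1, h2⟩ := Finset.mem_filter.1 hb₀
      refine le_trans (Finset.card_le_card ?_) h1
      intro b hb
      obtain ⟨-, -, h4⟩ := Finset.mem_filter.1 hb
      simp [h4, h2]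

/-- Fixing the first coordinates `u` fixes the columns on every scale, and `card_clumped_le` applies
to the second coordinates. -/
theorem card_spread_clumped_le {l s₀ T m h : ℕ} (hD : 0 < D) (hN : m * q = 4 * h)
    (hlD : m * l ≤ D) (hT : D ^ (s₀ + T) ≤ n) :
    (Nat.card {Y : Fin m → BobInput q n // (∀ j, Spread n q D l s₀ T (Y j)) ∧
      ∀ s, s₀ ≤ s → s < s₀ + T → (occupied n q D s Y).card < h} : ℝ) ≤
      2 ^ (m * q) * (2 ^ (m * q) * ((m * l : ℝ) / D) ^ h) ^ T *
        Fintype.card (BobInput q n) ^ m := by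
  classical
  rw [Nat.card_eq_fintype_card, Fintype.card_subtype]
  set A := Finset.univ.filter fun Y : Fin m → BobInput q n => (∀ j, Spread n q D l s₀ T (Y j)) ∧
      ∀ s, s₀ ≤ s → s < s₀ + T → (occupied n q D s Y).card < h with hA
  set I := Fin m × Fin q
  have hI : Fintype.card I = m * q := by simp [I]
  set V : (I → Fin n) → Finset (I → Fin n) := fun u => Finset.univ.filter fun v =>
    ∀ s, s₀ ≤ s → s < s₀ + T → Clumped D (m * l) h
      (fun i => (u i : ℕ) / colWidth n q D s) fun i => (v i : ℕ) / D ^ s with hV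
  have h1 : A.card ≤ ∑ u : I → Fin n, (V u).card := by
    rw [← Finset.card_sigma]
    refine Finset.card_le_card_of_injOn
      (fun Y => ⟨fun i => (Y i.1 i.2).1, fun i => (Y i.1 i.2).2⟩) ?_ ?_
    · intro Y hY
      obtain ⟨-, hsp, hocc⟩ := Finset.mem_filter.1 hY
      simp only [Finset.coe_sigma, Finset.coe_univ, Set.mem_sigma_iff, Set.mem_univ, true_and,
        hV, Finset.coe_filter, Finset.mem_univ, Set.mem_ofPred_eq]
      exact fun s hs hs' => clumped_of_spread hN Y hsp hs hs' (hocc s hs hs')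
    · intro Y _ Y' _ heq
      simp only [Sigma.mk.injEq, heq_eq_eq] at heq
      funext j i
      exact Prod.ext (congrFun heq.1 (j, i)) (congrFun heq.2 (j, i))
  have hDr : (0 : ℝ) < D := by exact_mod_cast hD
  have h2 : ∀ u, ((V u).card : ℝ) ≤
      (n : ℝ) ^ (m * q) * (2 ^ (m * q) * (2 ^ (m * q) * ((m * l : ℝ) / D) ^ h) ^ T) := by
    intro u
    have h3 := card_clumped_le (K := m * l) (h := h) hD hlD
      (fun s (i : I) => (u i : ℕ) / colWidth n q D s) s₀ T hT (V u)
      fun v hv => (Finset.mem_filter.1 hv).2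
    rw [hI] at h3
    have h4 : ((V u).card : ℝ) * ((D : ℝ) ^ T) ^ (m * q) ≤ (2 * n) ^ (m * q) *
        (2 ^ (m * q) * (((m * l : ℝ)) ^ h * (D : ℝ) ^ (m * q - h))) ^ T := by
      exact_mod_cast h3
    have h5 : (D : ℝ) ^ (m * q - h) = (D : ℝ) ^ (m * q) / (D : ℝ) ^ h := by
      rw [eq_div_iff (pow_pos hDr _).ne', ← pow_add]
      congr 1; omega
    rw [h5] at h4
    have hpos : (0 : ℝ) < ((D : ℝ) ^ T) ^ (m * q) := by positivity
    refine le_of_mul_le_mul_right (h4.trans (le_of_eq ?_)) hpos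
    rw [div_pow, ← pow_mul (D : ℝ) T, mul_comm T, pow_mul (D : ℝ) _ T]
    generalize (D : ℝ) ^ (m * q) = a
    generalize (D : ℝ) ^ h = b
    rw [mul_pow 2 (n : ℝ)]
    generalize (2 : ℝ) ^ (m * q) = e
    generalize (m * l : ℝ) ^ h = f
    rw [show e * (f * (a / b)) = e * (f / b) * a by ring, mul_pow _ a]
    ring
  calc (A.card : ℝ) ≤ ∑ u : I → Fin n, ((V u).card : ℝ) := by exact_mod_cast h1
    _ ≤ _ := Finset.sum_le_card_nsmul _ _ _ fun u _ => h2 u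
    _ = _ := by
      rw [nsmul_eq_mul, Finset.card_univ]
      simp only [Fintype.card_fun, Fintype.card_prod, Fintype.card_fin, hI, Nat.cast_pow,
        Nat.cast_mul]
      rw [← pow_mul, mul_comm q m, mul_pow]
      ring

end Grids

end ORC

namespace ORC

/-! ### Guesses without communication. -/

section Core

variable {k q n l D m e s₀ T : ℕ}

/-- If the queries of `m` inputs of Bob occupy many cells on some scale, few inputs of Alice have
prescribed answers to all of them. -/
theorem card_all_answers_le {s : ℕ} (hq : 0 < q) (hqn : q ≤ n) (hD : 0 < D) (hedge : 5 * q ≤ e)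
    (hs : D ^ (s + 1) ≤ n) (hn : n ≤ q * D ^ s) {b : ℝ} (hb : 1 / √(n : ℝ) ≤ b) (hb1 : b ≤ 1)
    (hexp : 2 * Real.exp (-(k / (4 * q * D))) ≤ b) (Y : Fin m → BobInput q n)
    (hocc : 5 * e ≤ (occupied n q D s Y).card) (G : BobInput q n → Fin q → ℕ) :
    ((Finset.univ.filter fun x : AliceInput k n =>
      ∀ j, count2D k q n x (Y j) = G (Y j)).card : ℝ) ≤
      2 * b ^ e * Fintype.card (AliceInput k n) := by
  classical
  have hn0 : 0 < n := hq.trans_le hqn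
  have hU := colWidth_pos hq hqn hD hs
  have hV : 0 < D ^ s := pow_pos hD s
  have harea := le_colWidth_mul hq hqn hD hs
  have hrange : ∀ h ∈ occupied n q D s Y, h.1 < n / colWidth n q D s + 1 ∧ h.2 < n / D ^ s + 1 := by
    intro h hh
    obtain ⟨i, -, rfl⟩ := Finset.mem_image.1 hh
    simpa using gridCell_mem (q := q) (D := D) (s := s) (t := s) (Y i.1 i.2)
  obtain ⟨H, hHsub, hpos, hpar, hcard⟩ := exists_parity_class _ hrange
  have hV' : n / D ^ s ≤ q := by
    rw [Nat.div_le_iff_le_mul_add_pred hV]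
    have := hn
    rw [mul_comm] at this
    omega
  have hU' : n / colWidth n q D s ≤ 2 * q := by
    have h1 : n ≤ colWidth n q D s * (2 * q) := by
      have h2 : n * n ≤ colWidth n q D s * (2 * q) * n := by
        calc n * n = n ^ 2 := (sq n).symm
          _ ≤ 2 * (q * (colWidth n q D s * D ^ (s + 1))) := harea
          _ = colWidth n q D s * (2 * q) * D ^ (s + 1) := by ring
          _ ≤ _ := Nat.mul_le_mul_left _ hs
      exact Nat.le_of_mul_le_mul_right h2 hn0
    exact Nat.div_le_of_le_mul h1
  -- The parity class loses a factor `4` and at most `(2 q + 1) + (q + 1) ≤ 5 q ≤ e` boundary cells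
  -- out of `5 e`.
  have hHe : e ≤ H.card := by omega
  have hb0 : 0 ≤ b := le_trans (by positivity) hb
  have h1 := card_answers_le k hn0 hU hV (fun i : Fin m × Fin q => Y i.1 i.2) H
    (fun h hh => by
      obtain ⟨i, -, hi⟩ := Finset.mem_image.1 (hHsub hh)
      exact ⟨i, hi⟩) hpos hpar fun i => G (Y i.1) i.2
  have hsubset : (Finset.univ.filter fun x : AliceInput k n =>
      ∀ j, count2D k q n x (Y j) = G (Y j)) ⊆ Finset.univ.filter fun x : AliceInput k n =>
      ∀ i : Fin m × Fin q, ∑ j ∈ Finset.univ.filter (fun j => (x j).1 ≤ Y i.1 i.2),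
        (((x j).2 : ℕ) + 1) = G (Y i.1) i.2 := by
    intro x hx
    refine Finset.mem_filter.2 ⟨Finset.mem_univ _, fun i => ?_⟩
    exact congrFun ((Finset.mem_filter.1 hx).2 i.1) i.2
  refine (Nat.cast_le.2 (Finset.card_le_card hsubset)).trans (h1.trans ?_)
  refine mul_le_mul_of_nonneg_right ?_ (Nat.cast_nonneg _)
  have hnr : (0 : ℝ) < n := by exact_mod_cast hn0
  have hqr : (0 : ℝ) < q := by exact_mod_cast hq
  have hDr : (0 : ℝ) < D := by exact_mod_cast hD
  -- A fine cell has area at least `n² / (2 q D)`.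
  have h2 : (k : ℝ) / (4 * q * D) * H.card ≤
      k * (H.card * ((colWidth n q D s : ℕ) * (D ^ s : ℕ)) / (2 * n ^ 2)) := by
    have h3 : (n : ℝ) ^ 2 ≤ 2 * (q * ((colWidth n q D s : ℕ) * (D : ℝ) ^ (s + 1))) := by
      exact_mod_cast harea
    rw [div_mul_eq_mul_div, mul_div_assoc, mul_assoc]
    have h4 : (H.card : ℝ) / (4 * (q * D)) ≤
        H.card * ((colWidth n q D s : ℕ) * (D ^ s : ℕ)) / (2 * n ^ 2) := by
      rw [div_le_div_iff₀ (by positivity) (by positivity)]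
      push_cast
      rw [pow_succ (D : ℝ) s] at h3
      calc (H.card : ℝ) * (2 * n ^ 2) ≤
            H.card * (2 * (2 * (q * ((colWidth n q D s : ℕ) * ((D : ℝ) ^ s * D))))) := by gcongr
        _ = _ := by ring
    simpa only [mul_assoc] using mul_le_mul_of_nonneg_left h4 (Nat.cast_nonneg k)
  have h5 : 2 ^ H.card * Real.exp (-(k * (H.card * ((colWidth n q D s : ℕ) * (D ^ s : ℕ)) /
      (2 * n ^ 2)))) ≤ b ^ e := by
    calc _ ≤ 2 ^ H.card * Real.exp (-((k : ℝ) / (4 * q * D) * H.card)) := by gcongr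
      _ = (2 * Real.exp (-(k / (4 * q * D)))) ^ H.card := by
          rw [mul_pow, ← Real.exp_nat_mul]
          congr 2; ring
      _ ≤ b ^ H.card := pow_le_pow_left₀ (by positivity) hexp _
      _ ≤ b ^ e := pow_le_pow_of_le_one hb0 hb1 hHe
  have h6 : (1 / √(n : ℝ)) ^ H.card ≤ b ^ e :=
    (pow_le_pow_left₀ (by positivity) hb _).trans (pow_le_pow_of_le_one hb0 hb1 hHe)
  linarith

/-- If, for most `m`-tuples of elements of `B`, few `x` are related to all its members, then every
large set `S` has few related pairs with `B`. -/
theorem card_related_le {X Y : Type} [Fintype X] [Fintype Y] [DecidableEq Y] {m : ℕ} (hm : m ≠ 0)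
    (R : X → Y → Prop) [∀ x y, Decidable (R x y)] (B : Finset Y) (C : Finset (Fin m → Y))
    {ε₁ ε₂ β γ : ℝ} (hε₂ : 0 ≤ ε₂) (hβ : 0 ≤ β) (hγ : 0 ≤ γ) (hε : ε₁ + ε₂ ≤ γ * β ^ m)
    (hC : (C.card : ℝ) ≤ ε₁ * (Fintype.card Y : ℝ) ^ m)
    (hB : ∀ v : Fin m → Y, (∀ j, v j ∈ B) → v ∉ C →
      ((Finset.univ.filter fun x => ∀ j, R x (v j)).card : ℝ) ≤ ε₂ * Fintype.card X)
    (S : Finset X) :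
    (((S ×ˢ B).filter fun p => R p.1 p.2).card : ℝ) ≤
      β * S.card * Fintype.card Y + γ * Fintype.card X * Fintype.card Y := by
  classical
  set d : X → Finset Y := fun x => B.filter fun y => R x y with hd
  have hA : ((S ×ˢ B).filter fun p => R p.1 p.2).card = ∑ x ∈ S, (d x).card := by
    rw [Finset.card_filter, Finset.sum_product]
    exact Finset.sum_congr rfl fun x _ => (Finset.card_filter _ _).symm
  rw [hA]
  push_cast
  -- The `m`-th power counts the `m`-tuples of `B` related to `x`; the sum is evaluated tuple by
  -- tuple, those in `C` bounded trivially.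
  have hcopies : ∑ x : X, ((d x).card : ℝ) ^ m ≤
      γ * β ^ m * Fintype.card X * (Fintype.card Y : ℝ) ^ m := by
    set Z := Fintype.piFinset fun _ : Fin m => B
    set cor : (Fin m → Y) → Finset X := fun v =>
      Finset.univ.filter fun x => ∀ j, R x (v j) with hcor
    have h1 : ∑ x : X, (d x).card ^ m = ∑ v ∈ Z, (cor v).card := by
      have h2 : ∀ x : X, (d x).card ^ m = (Z.filter fun v => ∀ j, R x (v j)).card := by
        intro x
        rw [← Fintype.card_piFinset_const]
        congr 1
        ext v
        simp [Z, hd, forall_and]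
      rw [Finset.sum_congr rfl fun x _ => h2 x]
      exact Finset.sum_card_bipartiteAbove_eq_sum_card_bipartiteBelow
        fun (x : X) (v : Fin m → Y) => ∀ j, R x (v j)
    have h3 : ∀ v ∈ Z, ((cor v).card : ℝ) ≤
        (if v ∈ C then (Fintype.card X : ℝ) else 0) + ε₂ * Fintype.card X := by
      intro v hv
      split_ifs with hvC
      · refine le_trans ?_ (le_add_of_nonneg_right (by positivity))
        exact_mod_cast Finset.card_le_univ (cor v)
      · rw [zero_add]
        exact hB v (Fintype.mem_piFinset.1 hv) hvC
    calc ∑ x : X, ((d x).card : ℝ) ^ m = ∑ v ∈ Z, ((cor v).card : ℝ) := by exact_mod_cast h1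
      _ ≤ ∑ v ∈ Z, ((if v ∈ C then (Fintype.card X : ℝ) else 0) +
            ε₂ * Fintype.card X) := Finset.sum_le_sum h3
      _ ≤ ∑ v : Fin m → Y, ((if v ∈ C then (Fintype.card X : ℝ) else 0) +
            ε₂ * Fintype.card X) := by
          refine Finset.sum_le_sum_of_subset_of_nonneg (Finset.subset_univ _) fun v _ _ => ?_
          split_ifs <;> positivity
      _ = C.card * Fintype.card X + (Fintype.card Y : ℝ) ^ m * (ε₂ * Fintype.card X) := by
          rw [Finset.sum_add_distrib, Finset.sum_ite_mem, Finset.univ_inter, Finset.sum_const,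
            Finset.sum_const, nsmul_eq_mul, nsmul_eq_mul, Finset.card_univ, Fintype.card_fun,
            Fintype.card_fin, Nat.cast_pow]
      _ ≤ (ε₁ * (Fintype.card Y : ℝ) ^ m) * Fintype.card X +
            (Fintype.card Y : ℝ) ^ m * (ε₂ * Fintype.card X) := by gcongr
      _ = (ε₁ + ε₂) * Fintype.card X * (Fintype.card Y : ℝ) ^ m := by ring
      _ ≤ _ := by gcongr
  rcases le_or_gt (S.card : ℝ) (γ * Fintype.card X) with hS | hS
  · calc ∑ x ∈ S, ((d x).card : ℝ) ≤ ∑ x ∈ S, (Fintype.card Y : ℝ) :=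
          Finset.sum_le_sum fun x _ => by exact_mod_cast Finset.card_le_univ (d x)
      _ = S.card * Fintype.card Y := by rw [Finset.sum_const, nsmul_eq_mul]
      _ ≤ γ * Fintype.card X * Fintype.card Y := by gcongr
      _ ≤ _ := le_add_of_nonneg_left (by positivity)
  · refine le_trans ?_ (le_add_of_nonneg_right (by positivity))
    obtain ⟨m', rfl⟩ : ∃ m', m = m' + 1 := ⟨m - 1, by omega⟩
    have hX : (0 : ℝ) ≤ γ * Fintype.card X := by positivity
    have hSpos : (0 : ℝ) < S.card := hX.trans_lt hS
    -- Since `S` is larger than `γ |X|`, the power mean inequality turns the moment bound over all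
    -- of `X` into an average of at most `β |Y|` on `S`.
    have hpow := pow_sum_div_card_le_sum_pow (s := S) (f := fun x => ((d x).card : ℝ))
      (fun _ _ => Nat.cast_nonneg _) m'
    rw [div_le_iff₀ (pow_pos hSpos _)] at hpow
    refine le_of_pow_le_pow_left₀ hm (by positivity) (hpow.trans ?_)
    calc (∑ x ∈ S, ((d x).card : ℝ) ^ (m' + 1)) * (S.card : ℝ) ^ m'
        ≤ (∑ x, ((d x).card : ℝ) ^ (m' + 1)) * (S.card : ℝ) ^ m' := by
          refine mul_le_mul_of_nonneg_right ?_ (by positivity)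
          exact Finset.sum_le_sum_of_subset_of_nonneg (Finset.subset_univ _)
            fun x _ _ => by positivity
      _ ≤ (γ * β ^ (m' + 1) * Fintype.card X *
            (Fintype.card Y : ℝ) ^ (m' + 1)) * (S.card : ℝ) ^ m' := by gcongr
      _ = (γ * Fintype.card X) * (β ^ (m' + 1) *
            (Fintype.card Y : ℝ) ^ (m' + 1) * (S.card : ℝ) ^ m') := by ring
      _ ≤ S.card * (β ^ (m' + 1) *
            (Fintype.card Y : ℝ) ^ (m' + 1) * (S.card : ℝ) ^ m') := by gcongr
      _ = _ := by ring

/-- A guess depending only on Bob's input is rarely correct on a set `S` of inputs of Alice. -/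
theorem card_correct_le (hm : m ≠ 0) (hq : 0 < q) (hqn : q ≤ n) (hD : 0 < D)
    (hN : m * q = 20 * e) (hedge : 5 * q ≤ e) (hlD : m * l ≤ D) (hT : D ^ (s₀ + T) ≤ n)
    (hn : n ≤ q * D ^ s₀) {b β γ : ℝ} (hb : 1 / √(n : ℝ) ≤ b) (hb1 : b ≤ 1)
    (hexp : 2 * Real.exp (-(k / (4 * q * D))) ≤ b) (hβ : 0 ≤ β) (hγ : 0 ≤ γ)
    (hε : 2 ^ (m * q) * (2 ^ (m * q) * ((m * l : ℝ) / D) ^ (5 * e)) ^ T + 2 * b ^ e ≤ γ * β ^ m)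
    (B : Finset (BobInput q n)) (hB : ∀ y ∈ B, Spread n q D l s₀ T y)
    (S : Finset (AliceInput k n)) (G : BobInput q n → Fin q → ℕ) :
    (((S ×ˢ B).filter fun p => count2D k q n p.1 p.2 = G p.2).card : ℝ) ≤
      β * S.card * Fintype.card (BobInput q n) +
        γ * Fintype.card (AliceInput k n) * Fintype.card (BobInput q n) := by
  classical
  have hb0 : 0 ≤ b := le_trans (by positivity) hb
  refine card_related_le hm (fun x y => count2D k q n x y = G y) B
    (Finset.univ.filter fun v : Fin m → BobInput q n => (∀ j, Spread n q D l s₀ T (v j)) ∧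
        ∀ s, s₀ ≤ s → s < s₀ + T → (occupied n q D s v).card < 5 * e)
    (ε₂ := 2 * b ^ e) (by positivity) hβ hγ hε ?_ (fun v hv hvC => ?_) S
  · have := card_spread_clumped_le (n := n) (q := q) (l := l) (s₀ := s₀) (T := T) (h := 5 * e)
      hD (by omega) hlD hT
    rwa [Nat.card_eq_fintype_card, Fintype.card_subtype] at this
  · obtain ⟨s, hs, hs', hocc⟩ : ∃ s, s₀ ≤ s ∧ s < s₀ + T ∧
        5 * e ≤ (occupied n q D s v).card := by
      by_contra! hcon
      exact hvC (Finset.mem_filter.2 ⟨Finset.mem_univ _, fun j => hB _ (hv j), hcon⟩)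
    exact card_all_answers_le hq hqn hD hedge
      ((Nat.pow_le_pow_right hD (by omega)).trans hT)
      (hn.trans (Nat.mul_le_mul_left _ (Nat.pow_le_pow_right hD hs))) hb hb1 hexp v hocc G

end Core

end ORC

namespace ORC

/-! ### Numerical estimates. -/

section Estimates

/-- `l` is large, and `t` is its binary logarithm. -/
structure IsLargeLog (l : ℕ) (t : ℝ) : Prop where
  rpow_eq : (2 : ℝ) ^ t = l
  le_log : 1000 ≤ t
  log_le : 1000000 * t ≤ l

variable {l : ℕ} {t : ℝ}

theorem IsLargeLog.pow_eq (h : IsLargeLog l t) (j : ℕ) : (l : ℝ) ^ j = (2 : ℝ) ^ (t * j) := by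
  rw [← h.rpow_eq, ← Real.rpow_natCast, ← Real.rpow_mul (by norm_num)]

theorem IsLargeLog.le (h : IsLargeLog l t) : 1000000000 ≤ (l : ℝ) := by
  linarith [h.le_log, h.log_le]

theorem IsLargeLog.pos (h : IsLargeLog l t) : 0 < l := by
  have := h.le
  have h1 : (0 : ℝ) < l := by linarith
  exact_mod_cast h1

theorem two_pow_eq_rpow (j : ℕ) : (2 : ℝ) ^ j = (2 : ℝ) ^ (j : ℝ) := (Real.rpow_natCast 2 j).symm

theorem rpow_le_two {x y : ℝ} (h : x ≤ y) : (2 : ℝ) ^ x ≤ (2 : ℝ) ^ y :=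
  Real.rpow_le_rpow_of_exponent_le (by norm_num) h

/-- Each scale gains `l^(-489 · 5 e)` up to `2^O(e)`, as `500 + 1 - 990 = -489`. There are about `B
/ 3 ≈ l / (2970 t)` scales, and `2445 / 2970 > 0.5`; the drop to `0.4` absorbs the constants. -/
theorem scales_bound (h : IsLargeLog l t) {B T e : ℕ} (hB : 2 ^ l ≤ (l ^ 990) ^ (B + 1))
    (hT : B ≤ 3 * T + 4) (he : 0 < e) :
    (2 : ℝ) ^ (20 * e) * (2 ^ (20 * e) * ((20 * (l : ℝ) ^ 500 * l) / (l : ℝ) ^ 990) ^ (5 * e)) ^ T +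
      2 * ((2 : ℝ) ^ (-(l : ℝ) / 2)) ^ e ≤ (2 : ℝ) ^ (-(0.4 * (l : ℝ) * e)) := by
  have ht := h.le_log
  have htl := h.log_le
  have hl := h.le
  have hl0 : (0 : ℝ) < l := by linarith
  have he1 : (1 : ℝ) ≤ e := by exact_mod_cast he
  have hBr : (l : ℝ) ≤ t * (990 * (B + 1)) := by
    have h1 : (2 : ℝ) ^ l ≤ (l : ℝ) ^ (990 * (B + 1)) := by
      rw [pow_mul]; exact_mod_cast hB
    rw [h.pow_eq, two_pow_eq_rpow, Real.rpow_le_rpow_left_iff (by norm_num)] at h1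
    push_cast at h1
    exact h1
  have hTr : (B : ℝ) ≤ 3 * T + 4 := by exact_mod_cast hT
  have hq : (20 * (l : ℝ) ^ 500 * l) / (l : ℝ) ^ 990 ≤ (2 : ℝ) ^ (5 - 489 * t) := by
    rw [mul_assoc, ← pow_succ, h.pow_eq, h.pow_eq, mul_div_assoc, ← Real.rpow_sub (by norm_num)]
    calc (20 : ℝ) * 2 ^ (t * ((500 + 1 : ℕ) : ℝ) - t * ((990 : ℕ) : ℝ))
        ≤ 2 ^ (5 : ℝ) * 2 ^ (t * ((500 + 1 : ℕ) : ℝ) - t * ((990 : ℕ) : ℝ)) := by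
          gcongr
          norm_num
      _ = _ := by
          rw [← Real.rpow_add (by norm_num)]
          congr 1
          push_cast
          ring
  have hbase : (2 : ℝ) ^ (20 * e) * (2 ^ (20 * e) *
      ((20 * (l : ℝ) ^ 500 * l) / (l : ℝ) ^ 990) ^ (5 * e)) ^ T ≤ (2 : ℝ) ^ (-(0.5 * (l : ℝ) * e)) := by
    calc _ ≤ (2 : ℝ) ^ (20 * e) * (2 ^ (20 * e) * ((2 : ℝ) ^ (5 - 489 * t)) ^ (5 * e)) ^ T := by
          gcongr
      _ = (2 : ℝ) ^ ((20 + (45 - 2445 * t) * T) * e) := by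
          simp only [two_pow_eq_rpow]
          rw [← Real.rpow_natCast (2 ^ (5 - 489 * t)), ← Real.rpow_mul (by norm_num),
            ← Real.rpow_add (by norm_num), ← Real.rpow_natCast, ← Real.rpow_mul (by norm_num),
            ← Real.rpow_add (by norm_num)]
          congr 1
          push_cast
          ring
      _ ≤ _ := by
          refine rpow_le_two ?_
          rw [← neg_mul]
          refine mul_le_mul_of_nonneg_right ?_ (by linarith)
          have hT0 : (0 : ℝ) ≤ T := Nat.cast_nonneg T
          have h1 : (l : ℝ) ≤ 990 * t * (3 * T + 5) := by nlinarith
          have h2 : 1000 * (T : ℝ) ≤ t * T := mul_le_mul_of_nonneg_right ht hT0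
          nlinarith
  have hsecond : ((2 : ℝ) ^ (-(l : ℝ) / 2)) ^ e = (2 : ℝ) ^ (-(0.5 * (l : ℝ) * e)) := by
    rw [← Real.rpow_natCast, ← Real.rpow_mul (by norm_num)]
    congr 1
    ring
  rw [hsecond]
  calc _ ≤ (2 : ℝ) ^ (-(0.5 * (l : ℝ) * e)) + 2 * (2 : ℝ) ^ (-(0.5 * (l : ℝ) * e)) := by gcongr
    _ = 3 * (2 : ℝ) ^ (-(0.5 * (l : ℝ) * e)) := by ring
    _ ≤ 2 ^ (2 : ℝ) * (2 : ℝ) ^ (-(0.5 * (l : ℝ) * e)) := by gcongr; norm_num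
    _ = (2 : ℝ) ^ (2 + -(0.5 * (l : ℝ) * e)) := (Real.rpow_add (by norm_num) _ _).symm
    _ ≤ _ := by
        refine rpow_le_two ?_
        nlinarith

/-- Naming the cells costs only `2 ^ (2 q)` because `8 q ≤ 2 ^ (l + 4)`, while the gain is `l^(-q/2)
= 2^(-t q / 2)`. The `t + 1` bounds `log log n`, and the final `-1` allows for a second error term
of the same size. -/
theorem crowded_bound (h : IsLargeLog l t) {q T : ℕ} (hq : l ≤ q) (hq2 : q ≤ 2 ^ (l + 1))
    (hT : T ≤ l) :
    (T : ℝ) * ((8 * q : ℝ) ^ (q / l) * 2 ^ q * (1 / √l) ^ q) ≤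
      (2 : ℝ) ^ (-(0.2 * q * (t + 1)) - 1) := by
  have ht := h.le_log
  have htl := h.log_le
  have hl := h.le
  have hl0 : (0 : ℝ) < l := by linarith
  have hqr : (l : ℝ) ≤ q := by exact_mod_cast hq
  have h1 : (8 * q : ℝ) ^ (q / l) ≤ (2 : ℝ) ^ (2 * (q : ℝ)) := by
    have h2 : (8 * q : ℝ) ≤ 2 ^ (l + 4) := by
      have : 8 * q ≤ 2 ^ (l + 4) := by rw [show l + 4 = l + 1 + 3 by ring, pow_add]; linarith
      exact_mod_cast this
    calc _ ≤ ((2 : ℝ) ^ (l + 4)) ^ (q / l) := by gcongr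
      _ = 2 ^ ((l + 4) * (q / l)) := by rw [pow_mul]
      _ ≤ 2 ^ (2 * q) := by
          refine pow_le_pow_right₀ (by norm_num) ?_
          have h4 : 4 ≤ l := by
            have : (4 : ℝ) ≤ l := by linarith
            exact_mod_cast this
          have := Nat.mul_div_le q l
          nlinarith
      _ = _ := by rw [two_pow_eq_rpow]; push_cast; rfl
  have h2 : 1 / √(l : ℝ) = (2 : ℝ) ^ (-(t / 2)) := by
    rw [Real.sqrt_eq_rpow, ← h.rpow_eq, ← Real.rpow_mul (by norm_num), one_div,
      ← Real.rpow_neg (by norm_num)]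
    congr 1
    ring
  have h3 : (T : ℝ) ≤ (2 : ℝ) ^ t := by rw [h.rpow_eq]; exact_mod_cast hT
  rw [h2, two_pow_eq_rpow, ← Real.rpow_natCast (2 ^ _), ← Real.rpow_mul (by norm_num)]
  calc _ ≤ (2 : ℝ) ^ t * (2 ^ (2 * (q : ℝ)) * 2 ^ (q : ℝ) * 2 ^ (-(t / 2) * (q : ℝ))) := by gcongr
    _ = 2 ^ (t + (2 * (q : ℝ) + q + -(t / 2) * q)) := by
        rw [← Real.rpow_add (by norm_num), ← Real.rpow_add (by norm_num),
          ← Real.rpow_add (by norm_num)]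
    _ ≤ _ := by
        refine rpow_le_two ?_
        nlinarith

/-- Against `β` one compares `0.006 + 2 · 0.0006 < 0.01`. Against `γ`, Alice's budget `e` is
negligible beside `0.2 l e`. What remains is exponentially small in `q l`, far below what is needed.
-/
theorem messages_bound (h : IsLargeLog l t) {q cA cB cM : ℕ} (hq : 0 < q)
    (hA : (cA : ℝ) ≤ q * (l : ℝ) ^ 500) (hB : (cB : ℝ) ≤ 0.006 * q * l)
    (hM : (cM : ℝ) ≤ 0.0006 * q * l) :
    ((cM : ℝ) + 1) * 2 ^ cM * (2 ^ cB * (2 : ℝ) ^ (-(0.01 * (l : ℝ) * q)) +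
      2 ^ cA * 2 ^ cB * (2 : ℝ) ^ (-(0.2 * (l : ℝ) * (q * (l : ℝ) ^ 500)))) ≤
      (2 : ℝ) ^ (-(0.2 * q * (t + 1)) - 1) := by
  have ht := h.le_log
  have htl := h.log_le
  have hl := h.le
  have hl0 : (0 : ℝ) < l := by linarith
  have hq1 : (1 : ℝ) ≤ q := by exact_mod_cast hq
  set e : ℝ := q * (l : ℝ) ^ 500 with he
  have hqe : (q : ℝ) ≤ e := le_mul_of_one_le_right (by linarith) (one_le_pow₀ (by linarith))
  have hM' : ((cM : ℝ) + 1) ≤ 2 ^ cM := by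
    have := Nat.lt_two_pow_self (n := cM)
    exact_mod_cast this
  have hql : (l : ℝ) ≤ q * l := le_mul_of_one_le_left hl0.le hq1
  have hqt : 1000000 * (q * t) ≤ q * l := by nlinarith
  have hqq : 1000 * (q : ℝ) ≤ q * l := by nlinarith
  have h1 : (2 : ℝ) ^ cB * (2 : ℝ) ^ (-(0.01 * (l : ℝ) * q)) ≤ 2 ^ (-(0.004 * ((l : ℝ) * q))) := by
    rw [two_pow_eq_rpow, ← Real.rpow_add (by norm_num)]
    refine rpow_le_two ?_
    linarith
  have h2 : (2 : ℝ) ^ cA * 2 ^ cB * (2 : ℝ) ^ (-(0.2 * (l : ℝ) * e)) ≤ 2 ^ (-(0.004 * ((l : ℝ) * q))) := by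
    rw [two_pow_eq_rpow, two_pow_eq_rpow, ← Real.rpow_add (by norm_num),
      ← Real.rpow_add (by norm_num)]
    refine rpow_le_two ?_
    have h3 : l * (q : ℝ) ≤ l * e := mul_le_mul_of_nonneg_left hqe hl0.le
    have h4 : 1000 * e ≤ l * e := mul_le_mul_of_nonneg_right (by linarith) (by linarith)
    linarith
  calc _ ≤ (2 : ℝ) ^ cM * 2 ^ cM * (2 ^ (-(0.004 * ((l : ℝ) * q))) + 2 ^ (-(0.004 * ((l : ℝ) * q)))) := by
        gcongr
    _ = (2 : ℝ) ^ ((cM : ℝ) + cM + (-(0.004 * ((l : ℝ) * q)) + 1)) := by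
        rw [Real.rpow_add (by norm_num), Real.rpow_add (by norm_num),
          Real.rpow_add (by norm_num) (-(0.004 * ((l : ℝ) * q))), two_pow_eq_rpow, Real.rpow_one]
        ring
    _ ≤ _ := by
        refine rpow_le_two ?_
        linarith

end Estimates

end ORC

namespace ORC

/-! ### Choice of the parameters. -/

section Regime

variable {l : ℕ} {t : ℝ}

theorem eventually_isLargeLog : ∀ᶠ l : ℕ in atTop, IsLargeLog l (Real.logb 2 l) := by
  have hlog : ∀ᶠ x : ℝ in atTop, 1000000 * Real.logb 2 x ≤ x := by
    have h1 := Real.isLittleO_log_id_atTop.def (c := Real.log 2 / 1000000)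
      (div_pos (Real.log_pos (by norm_num)) (by norm_num))
    filter_upwards [h1, eventually_ge_atTop 1] with x hx hx1
    have hx0 : 0 ≤ Real.log x := Real.log_nonneg hx1
    rw [id, Real.norm_of_nonneg hx0, Real.norm_of_nonneg (by linarith)] at hx
    rw [Real.logb, ← mul_div_assoc, div_le_iff₀ (Real.log_pos (by norm_num))]
    linarith
  have hcast := tendsto_natCast_atTop_atTop (R := ℝ)
  filter_upwards [hcast.eventually hlog,
    hcast.eventually ((Real.tendsto_logb_atTop (b := 2) (by norm_num)).eventually_ge_atTop 1000),
    eventually_gt_atTop 0] with l h1 h2 h3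
  exact ⟨Real.rpow_logb (by norm_num) (by norm_num) (by exact_mod_cast h3), h2, h1⟩

theorem IsLargeLog.pow_le (h : IsLargeLog l t) {a j : ℕ} (ha : a ≤ 20) (hj : j ≤ 900000) :
    2 ^ a * l ^ j ≤ 2 ^ l := by
  have h1 : (2 : ℝ) ^ a * (l : ℝ) ^ j ≤ 2 ^ l := by
    rw [h.pow_eq, two_pow_eq_rpow, two_pow_eq_rpow, ← Real.rpow_add (by norm_num)]
    refine rpow_le_two ?_
    have h2 : (a : ℝ) ≤ 20 := by exact_mod_cast ha
    have h3 : (j : ℝ) ≤ 900000 := by exact_mod_cast hj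
    have h4 : t * j ≤ t * 900000 := mul_le_mul_of_nonneg_left h3 (by linarith [h.le_log])
    linarith [h.log_le, h.le_log]
  exact_mod_cast h1

/-- Bernoulli's inequality for `(x / (x + 1)) ^ j`. It replaces `log n` by its integer part inside a
1000th power. -/
theorem pow_le_two_mul_pow {x y : ℝ} {j : ℕ} (hx : 2 * (j : ℝ) ≤ x) (hy : 0 ≤ y)
    (hyx : y ≤ x + 1) : y ^ j ≤ 2 * x ^ j := by
  have hj : (0 : ℝ) ≤ j := Nat.cast_nonneg j
  have hx1 : 0 < x + 1 := by linarith
  have h1 : (1 : ℝ) + j * (-1 / (x + 1)) ≤ (1 + -1 / (x + 1)) ^ j := by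
    refine one_add_mul_le_pow ?_ j
    rw [le_div_iff₀ hx1]
    linarith
  have h2 : (1 : ℝ) + -1 / (x + 1) = x / (x + 1) := by field_simp; ring
  have h3 : (1 / 2 : ℝ) ≤ 1 + j * (-1 / (x + 1)) := by
    have : (j : ℝ) / (x + 1) ≤ 1 / 2 := by
      rw [div_le_iff₀ hx1]
      linarith
    rw [mul_div_assoc', mul_neg, mul_one, neg_div]
    linarith
  rw [h2, div_pow] at h1
  have h4 := h3.trans h1
  rw [le_div_iff₀ (pow_pos hx1 j)] at h4
  have h5 := pow_le_pow_left₀ hy hyx j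
  linarith

set_option exponentiation.threshold 1000 in
/-- A valid protocol for the dominance counting problem rarely succeeds, for any fixed public
string. -/
theorem card_succeeds_count2D_le (h : IsLargeLog l t) {k q n : ℕ} (hn : 2 ^ l ≤ n)
    (hn' : n < 2 ^ (l + 1)) (hlq : l ≤ q) (hqn : q ≤ n) (hnq : n ≤ q ^ 3) (hqk : q * l ^ 999 ≤ k)
    {cA cB cM : ℝ} (hA0 : 0 ≤ cA) (hB0 : 0 ≤ cB) (hM0 : 0 ≤ cM) (hA : cA ≤ q * (l : ℝ) ^ 500)
    (hB : cB ≤ 0.006 * q * l) (hM : cM ≤ 0.0006 * q * l)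
    (P : FourANC.Protocol (AliceInput k n) (BobInput q n) (Fin q → ℕ)) (r : FourANC.Coins)
    (hval : ∀ x y m g, P.Proceeds x y r m g ↔ P.megan x y m r = some g) :
    (Nat.card {p : AliceInput k n × BobInput q n //
      P.Succeeds (count2D k q n) cA cB cM p.1 p.2 r} : ℝ) ≤
      (2 : ℝ) ^ (-(0.2 * q * (t + 1))) *
        (Fintype.card (AliceInput k n) * Fintype.card (BobInput q n) : ℕ) := by
  classical
  have hl0 := h.pos
  have hlr := h.le
  have hl20 : 20 ≤ l := by
    have : (20 : ℝ) ≤ l := by linarith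
    exact_mod_cast this
  have hq : 0 < q := hl0.trans_le hlq
  have hn0 : 0 < n := hq.trans_le hqn
  -- `D` lies well above `m l = 20 l^501`, so that collisions are rare, and below `k / q ≥ l^999`,
  -- so that fine cells still expect at least of order `l^9` points of Alice.
  set D := l ^ 990 with hDdef
  have hD : 0 < D := pow_pos hl0 _
  have hD2 : 2 ≤ D := by
    calc 2 ≤ l ^ 1 := by rw [pow_one]; omega
      _ ≤ l ^ 990 := Nat.pow_le_pow_right hl0 (by norm_num)
  set B := Nat.log D n with hBdef
  have hBn : D ^ B ≤ n := Nat.pow_log_le_self D hn0.ne'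
  have hnB : n < D ^ (B + 1) := Nat.lt_pow_succ_log_self hD2 n
  have hB4 : 4 ≤ B := by
    refine Nat.le_log_of_pow_le hD2 (le_trans ?_ hn)
    have := h.pow_le (a := 0) (j := 3960) (by norm_num) (by norm_num)
    rw [hDdef, ← pow_mul]
    simpa using this
  -- The least `s₀` with `3 s₀ ≥ 2 (B + 1)`, so that `D ^ s₀ ≥ n^(2/3) ≥ n / q`; about a third of
  -- the scales remain.
  set s₀ := (2 * B + 4) / 3 with hs₀
  set T := B - s₀ with hTdef
  have hsT : s₀ + T = B := by omega
  have hT3 : B ≤ 3 * T + 4 := by omega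
  have hBl : B ≤ l := by
    have h1 : 2 ^ B < 2 ^ (l + 1) := (Nat.pow_le_pow_left hD2 B).trans_lt (hBn.trans_lt hn')
    have := (Nat.pow_lt_pow_iff_right (by norm_num)).1 h1
    omega
  have hnqD : n ≤ q * D ^ s₀ := by
    refine le_of_pow_le_pow_left₀ (n := 3) (by norm_num) (Nat.zero_le _) ?_
    calc n ^ 3 = n * n ^ 2 := by ring
      _ ≤ q ^ 3 * (D ^ (B + 1)) ^ 2 := Nat.mul_le_mul hnq (Nat.pow_le_pow_left hnB.le 2)
      _ = q ^ 3 * D ^ ((B + 1) * 2) := by rw [← pow_mul]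
      _ ≤ q ^ 3 * D ^ (s₀ * 3) := Nat.mul_le_mul_left _ (Nat.pow_le_pow_right hD (by omega))
      _ = (q * D ^ s₀) ^ 3 := by rw [mul_pow, ← pow_mul D]
  set m := 20 * l ^ 500 with hmdef
  set e := q * l ^ 500 with hedef
  have he : 0 < e := Nat.mul_pos hq (pow_pos hl0 _)
  have hmlD : m * l ≤ D := by
    calc m * l = 20 * l ^ 501 := by rw [hmdef]; ring
      _ ≤ l * l ^ 501 := Nat.mul_le_mul_right _ hl20
      _ = l ^ 502 := by ring
      _ ≤ l ^ 990 := Nat.pow_le_pow_right hl0 (by norm_num)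
  have hN : m * q = 20 * e := by rw [hmdef, hedef]; ring
  have hedge : 5 * q ≤ e := by
    rw [hedef, mul_comm 5 q]
    refine Nat.mul_le_mul_left _ ?_
    calc 5 ≤ l ^ 1 := by rw [pow_one]; omega
      _ ≤ l ^ 500 := Nat.pow_le_pow_right hl0 (by norm_num)
  have hnr : (2 : ℝ) ^ l ≤ n := by exact_mod_cast hn
  have hb : 1 / √(n : ℝ) ≤ (2 : ℝ) ^ (-(l : ℝ) / 2) := by
    have h1 : (2 : ℝ) ^ ((l : ℝ) / 2) ≤ √(n : ℝ) := by
      refine Real.le_sqrt_of_sq_le ?_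
      rw [← Real.rpow_natCast, ← Real.rpow_mul (by norm_num)]
      refine le_trans (le_of_eq ?_) hnr
      rw [two_pow_eq_rpow]
      congr 1
      push_cast
      ring
    rw [neg_div, Real.rpow_neg (by norm_num), ← one_div]
    exact one_div_le_one_div_of_le (by positivity) h1
  have hb1 : (2 : ℝ) ^ (-(l : ℝ) / 2) ≤ 1 :=
    Real.rpow_le_one_of_one_le_of_nonpos (by norm_num) (by linarith)
  have hlr0 : (0 : ℝ) < l := by linarith
  have hqr0 : (0 : ℝ) < q := by exact_mod_cast hq
  have hexp : 2 * Real.exp (-(k / (4 * q * (D : ℕ)))) ≤ (2 : ℝ) ^ (-(l : ℝ) / 2) := by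
    have h1 : (l : ℝ) + 1 ≤ k / (4 * q * (D : ℕ)) := by
      rw [le_div_iff₀ (by positivity)]
      have h2 : (q : ℝ) * (l : ℝ) ^ 999 ≤ k := by exact_mod_cast hqk
      refine le_trans ?_ h2
      have h3 : ((l : ℝ) + 1) * 4 ≤ (l : ℝ) ^ 9 := by
        calc ((l : ℝ) + 1) * 4 ≤ l * l := by nlinarith
          _ = (l : ℝ) ^ 2 := by ring
          _ ≤ _ := pow_le_pow_right₀ (by linarith) (by norm_num)
      calc ((l : ℝ) + 1) * (4 * q * (D : ℕ)) = ((l : ℝ) + 1) * 4 * (q * (l : ℝ) ^ 990) := by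
            rw [hDdef]; push_cast; ring
        _ ≤ (l : ℝ) ^ 9 * (q * (l : ℝ) ^ 990) := by gcongr
        _ = _ := by ring
    have h2 : Real.exp (-(k / (4 * q * (D : ℕ)))) ≤ (2 : ℝ) ^ (-((l : ℝ) + 1)) := by
      rw [Real.rpow_def_of_pos (by norm_num)]
      refine Real.exp_le_exp.2 ?_
      have h3 : Real.log 2 ≤ 1 := by linarith [Real.log_two_lt_d9]
      nlinarith
    calc _ ≤ 2 * (2 : ℝ) ^ (-((l : ℝ) + 1)) := by gcongr
      _ = (2 : ℝ) ^ (1 + -((l : ℝ) + 1)) := by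
          rw [Real.rpow_add (by norm_num), Real.rpow_one]
      _ ≤ _ := rpow_le_two (by linarith)
  -- As `m q = 20 e`, the choices give `γ β ^ m = 2^(-0.2 l e - 0.2 l e)`, matching `scales_bound`.
  set β : ℝ := (2 : ℝ) ^ (-(0.01 * (l : ℝ) * q)) with hβ
  set γ : ℝ := (2 : ℝ) ^ (-(0.2 * (l : ℝ) * (q * (l : ℝ) ^ 500))) with hγ
  have hε : (2 : ℝ) ^ (m * q) * (2 ^ (m * q) * (((m : ℕ) * l : ℝ) / (D : ℕ)) ^ (5 * e)) ^ T +
      2 * ((2 : ℝ) ^ (-(l : ℝ) / 2)) ^ e ≤ γ * β ^ m := by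
    have h1 := scales_bound h (hn.trans hnB.le) hT3 he
    have h2 : γ * β ^ m = (2 : ℝ) ^ (-(0.4 * (l : ℝ) * e)) := by
      rw [hγ, hβ, ← Real.rpow_natCast (2 ^ _), ← Real.rpow_mul (by norm_num),
        ← Real.rpow_add (by norm_num)]
      congr 1
      rw [hmdef, hedef]
      push_cast
      ring
    rw [h2, hN]
    refine le_trans (le_of_eq ?_) h1
    rw [hmdef, hDdef]
    push_cast
    rfl
  set Bad := Finset.univ.filter fun y : BobInput q n => ¬ Spread n q D l s₀ T y with hBad
  have hcore := card_correct_le (k := k) (l := l) (by positivity) hq hqn hD hN hedge hmlD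
    (hsT ▸ hBn) hnqD hb hb1 hexp (by positivity : 0 ≤ β) (by positivity : 0 ≤ γ) hε Badᶜ
    (fun y hy => by simpa [hBad] using hy)
  have hmain := P.card_succeeds_le r hval (count2D k q n) ⌊cA⌋₊ ⌊cB⌋₊ ⌊cM⌋₊ Bad β γ
    (by positivity) (by positivity) hcore
  -- Bit counts are integers, so the real budgets may be rounded down.
  have hmono : Nat.card {p : AliceInput k n × BobInput q n //
      P.Succeeds (count2D k q n) cA cB cM p.1 p.2 r} ≤
      Nat.card {p : AliceInput k n × BobInput q n //
        P.Succeeds (count2D k q n) ⌊cA⌋₊ ⌊cB⌋₊ ⌊cM⌋₊ p.1 p.2 r} := by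
    refine Nat.card_le_card_of_injective
      (fun p => ⟨p.1, ?_, ?_, ?_, p.2.2.2.2⟩) fun p p' hp => Subtype.ext (by
        have := congrArg Subtype.val hp
        exact this)
    · exact_mod_cast Nat.le_floor p.2.1
    · exact_mod_cast Nat.le_floor p.2.2.1
    · exact_mod_cast Nat.le_floor p.2.2.2.1
  have hq2 : q ≤ 2 ^ (l + 1) := hqn.trans hn'.le
  have hbad : (Bad.card : ℝ) ≤ (2 : ℝ) ^ (-(0.2 * q * (t + 1)) - 1) *
      Fintype.card (BobInput q n) := by
    have h1 := card_not_spread_le (l := l) hl0 hq hqn hD (hsT ▸ hBn) hnqD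
    rw [Nat.card_eq_fintype_card, Fintype.card_subtype] at h1
    refine h1.trans ?_
    gcongr
    exact crowded_bound h hlq hq2 (by omega)
  have hmsg := messages_bound h hq ((Nat.floor_le hA0).trans hA) ((Nat.floor_le hB0).trans hB)
    ((Nat.floor_le hM0).trans hM)
  calc _ ≤ _ := (Nat.cast_le (α := ℝ)).2 hmono
    _ ≤ _ := hmain
    _ ≤ ((2 : ℝ) ^ (-(0.2 * q * (t + 1)) - 1) * Fintype.card (BobInput q n) +
          (2 : ℝ) ^ (-(0.2 * q * (t + 1)) - 1) * Fintype.card (BobInput q n)) *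
          Fintype.card (AliceInput k n) := by gcongr
    _ = _ := by
        rw [Real.rpow_sub_one (by norm_num)]
        push_cast
        ring

end Regime

end ORC

/-! ### From the asymptotic hypotheses to the explicit regime. -/

theorem mainTheorem2 (k q : ℕ → ℕ)
    (hk : ∀ᶠ n : ℕ in atTop, Real.sqrt n ≤ (k n : ℝ) ∧ k n ≤ n)
    (hkq : (fun n : ℕ => (k n : ℝ) / (q n : ℝ)) ~[atTop]
      fun n : ℕ => Real.logb 2 n ^ (1000 : ℕ)) :
    ∀ᶠ n : ℕ in atTop,
      FourANC.suc (ORC.count2D (k n) (q n) n) (ORC.inputMeasure (k n) (q n) n)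
          (0.5 * Real.sqrt ((k n : ℝ) * (q n : ℝ)))
          (0.005 * (q n : ℝ) * Real.logb 2 n)
          (0.0005 * (q n : ℝ) * Real.logb 2 n)
        ≤ ENNReal.ofReal
          ((2 : ℝ) ^ (-(0.2 * (q n : ℝ) * Real.logb 2 (Real.logb 2 n)))) := by
  have hlog : Tendsto (Nat.log 2) atTop atTop := by
    refine tendsto_atTop.2 fun b => ?_
    filter_upwards [eventually_ge_atTop (2 ^ b)] with n hn
    exact Nat.le_log_of_pow_le (by norm_num) hn
  filter_upwards [hk, hkq.isLittleO.def (c := 1 / 2) (by norm_num),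
    hlog.eventually ORC.eventually_isLargeLog, eventually_gt_atTop 0] with n hkn hkqn hlarge hn0
  simp only [Pi.sub_apply] at hkqn
  set l := Nat.log 2 n with hl
  set t := Real.logb 2 (l : ℝ) with ht
  generalize k n = k at *
  generalize q n = q at *
  obtain ⟨hkl, hkn⟩ := hkn
  have hlr := hlarge.le
  have hl0 := hlarge.pos
  have hlr0 : (0 : ℝ) < l := by linarith
  have hn2 : 2 ^ l ≤ n := Nat.pow_log_le_self 2 hn0.ne'
  have hn2' : n < 2 ^ (l + 1) := Nat.lt_pow_succ_log_self (by norm_num) n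
  have hnr0 : (0 : ℝ) < n := by exact_mod_cast hn0
  set L := Real.logb 2 n with hL
  have hLl : (l : ℝ) ≤ L := by
    rw [hL, Real.le_logb_iff_rpow_le (by norm_num) hnr0, Real.rpow_natCast]
    exact_mod_cast hn2
  have hLl' : L ≤ l + 1 := by
    rw [hL, Real.logb_le_iff_le_rpow (by norm_num) hnr0]
    have : (2 : ℝ) ^ ((l : ℝ) + 1) = (2 : ℝ) ^ (l + 1) := by
      rw [← Real.rpow_natCast]; push_cast; rfl
    rw [this]
    exact_mod_cast hn2'.le
  have hpow : L ^ 1000 ≤ 2 * (l : ℝ) ^ 1000 :=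
    ORC.pow_le_two_mul_pow (by push_cast; linarith) (by linarith) hLl'
  have hLpos : 0 < L ^ 1000 := pow_pos (by linarith) _
  rw [Real.norm_eq_abs, Real.norm_of_nonneg hLpos.le, abs_le] at hkqn
  have hq : 0 < q := by
    -- For `q = 0` the quotient is `0` by convention, which is not within half of `L ^ 1000`.
    rcases Nat.eq_zero_or_pos q with rfl | h
    · simp only [Nat.cast_zero, div_zero] at hkqn
      linarith [hkqn.1]
    · exact h
  have hqr : (0 : ℝ) < q := by exact_mod_cast hq
  have hk1 : 1 / 2 * L ^ 1000 * q ≤ k := by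
    rw [← le_div_iff₀ hqr]; linarith [hkqn.1]
  have hk2 : (k : ℝ) ≤ 3 / 2 * L ^ 1000 * q := by
    rw [← div_le_iff₀ hqr]; linarith [hkqn.2]
  have hk3 : (k : ℝ) ≤ 4 * (l : ℝ) ^ 1000 * q := by
    refine hk2.trans (mul_le_mul_of_nonneg_right ?_ hqr.le)
    have : (0 : ℝ) < (l : ℝ) ^ 1000 := by positivity
    linarith
  have hqk : q * l ^ 999 ≤ k := by
    have h1 : (q : ℝ) * (l : ℝ) ^ 999 ≤ k := by
      refine le_trans ?_ hk1
      have h2 : (l : ℝ) ^ 1000 ≤ L ^ 1000 := pow_le_pow_left₀ hlr0.le hLl _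
      have h3 : 2 * (l : ℝ) ^ 999 ≤ (l : ℝ) ^ 1000 := by
        rw [pow_succ' (l : ℝ) 999]
        exact mul_le_mul_of_nonneg_right (by linarith) (by positivity)
      rw [mul_comm (q : ℝ)]
      exact mul_le_mul_of_nonneg_right (by linarith) hqr.le
    exact_mod_cast h1
  have hqn : q ≤ n := by
    refine le_trans ?_ (hqk.trans hkn)
    exact Nat.le_mul_of_pos_right _ (pow_pos hl0 _)
  have hnk : n ≤ 16 * l ^ 2000 * q ^ 2 := by
    have h1 : (n : ℝ) ≤ (4 * (l : ℝ) ^ 1000 * q) ^ 2 := by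
      rw [← Real.sqrt_le_left (by positivity)]
      exact hkl.trans hk3
    have h2 : (4 * (l : ℝ) ^ 1000 * q) ^ 2 = 16 * (l : ℝ) ^ 2000 * q ^ 2 := by ring
    rw [h2] at h1
    exact_mod_cast h1
  -- Otherwise `hnk` would bound `n` by a power of its logarithm. Together they give `n ≤ q ^ 3`,
  -- which leaves enough scales.
  have hq16 : 16 * l ^ 2000 ≤ q := by
    by_contra! hlt
    have h1 : 2 ^ l < 16 * l ^ 2000 * (16 * l ^ 2000) ^ 2 :=
      (hn2.trans hnk).trans_lt (Nat.mul_lt_mul_of_pos_left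
        (Nat.pow_lt_pow_left hlt (by norm_num)) (by positivity))
    have h2 := hlarge.pow_le (a := 12) (j := 6000) (by norm_num) (by norm_num)
    have h3 : 16 * l ^ 2000 * (16 * l ^ 2000) ^ 2 = 2 ^ 12 * l ^ 6000 := by ring
    omega
  have hnq : n ≤ q ^ 3 := by
    calc n ≤ 16 * l ^ 2000 * q ^ 2 := hnk
      _ ≤ q * q ^ 2 := Nat.mul_le_mul_right _ hq16
      _ = q ^ 3 := by ring
  have hlq : l ≤ q := by
    refine le_trans ?_ hq16
    calc l = 1 * l ^ 1 := by ring
      _ ≤ _ := Nat.mul_le_mul (by norm_num) (Nat.pow_le_pow_right hl0 (by norm_num))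
  have hA : 0.5 * Real.sqrt ((k : ℝ) * q) ≤ q * (l : ℝ) ^ 500 := by
    have h1 : Real.sqrt ((k : ℝ) * q) ≤ 2 * (q * (l : ℝ) ^ 500) := by
      rw [Real.sqrt_le_left (by positivity)]
      calc (k : ℝ) * q ≤ 4 * (l : ℝ) ^ 1000 * q * q := by gcongr
        _ = _ := by ring
    linarith
  have hLl2 : L ≤ 1.1 * l := by linarith
  have hB : 0.005 * (q : ℝ) * L ≤ 0.006 * q * l := by nlinarith
  have hM : 0.0005 * (q : ℝ) * L ≤ 0.0006 * q * l := by nlinarith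
  have hLt : Real.logb 2 L ≤ t + 1 := by
    have h1 : L ≤ (2 : ℝ) ^ (t + 1) := by
      rw [Real.rpow_add (by norm_num), Real.rpow_one, hlarge.rpow_eq]
      linarith
    rwa [Real.logb_le_iff_le_rpow (by norm_num) (by linarith)]
  have : NeZero n := ⟨hn0.ne'⟩
  refine (FourANC.suc_uniform_le _ _ _ _ (ENNReal.ofReal
    ((2 : ℝ) ^ (-(0.2 * (q : ℝ) * (t + 1))))) fun P r hval => ?_).trans ?_
  · have h1 := ORC.card_succeeds_count2D_le hlarge hn2 hn2' hlq hqn hnq hqk (by positivity)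
      (by have : 0 ≤ L := by linarith
          positivity)
      (by have : 0 ≤ L := by linarith
          positivity) hA hB hM P r hval
    have h2 := ENNReal.ofReal_le_ofReal h1
    rwa [ENNReal.ofReal_mul (by positivity), ENNReal.ofReal_natCast, ENNReal.ofReal_natCast] at h2
  · refine ENNReal.ofReal_le_ofReal (ORC.rpow_le_two ?_)
    have : 0.2 * (q : ℝ) * Real.logb 2 L ≤ 0.2 * q * (t + 1) := by gcongr
    linarith
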